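/- Let $r\ge 2$ and $I=[0,1)$. Let $\mathrm{ITM}(r)\subset\mathbb R^{2r-1}$ be the set of parameter vectors $(\gamma\,\beta)=(\gamma_1,\dots,\gamma_r,\beta_1,\dots,\beta_{r-1})$ with $0=\beta_0<\beta_1<\dots<\beta_{r-1}<\beta_r=1$ and $\gamma_i\in[-\beta_{i-1},1-\beta_i]$; such a vector defines the interval translation map $T\colon I\to I$, $T(x)=x+\gamma_i$ for $x\in[\beta_{i-1},\beta_i)$. Let $X=\bigcap_{n\ge0}T^n(I)$, and call $T$ of finite type if $T^{n+1}(I)=T^n(I)=X$ for some $n$. Every point $x$ is split into signed points $x^-<x^+$, and $T$ acts on them through one-sided limits, $T(x^\pm)=\bigl(\lim_{u\to x^{\pm}}T(u)\bigr)^{\pm}$. The critical points (discontinuities) are $\beta_1^\pm,\dots,\beta_{r-1}^\pm$. An interval component of $X$ is a connected component $J=[x,y)$ of $X$, viewed as $[x^+,y^-]$ on signed points. It is dynamically non-trivial if some point in its interior eventually lands on a critical point. The return time of $a\in J$ is the least $k\ge1$ with $T^k(a)\in J$; "before the return time" refers to times $0\le n<k$ (all $n\ge 0$ if there is no return). A ghost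 preimage of a critical point $\beta_*^{\pm}$ is a critical point $\beta_{**}^{\mp}$ with $T^n(\beta_{**}^{\mp})=\beta_*^{\mp}$ for some $n\ge1$. The ghost tree of $\beta\in\{\beta_1^\pm,\dots,\beta_{r-1}^\pm\}$ has root $\beta$ at level $0$, and its level $n+1$ vertices are the ghost preimages of its level $n$ vertices. A finite type $T$ satisfies ACC if: (A1) for every interval component $J$ and every signed point $a\in J$, the orbit of $a$ before the return time to $J$ contains at most one critical point; (A2) for every dynamically non-trivial interval component $J=[x^+,y^-]$, neither $x^+$ nor $y^-$ is at a critical point at any time before its return time to $J$; (A3) no critical point $\beta\notin X$ occurs in its own ghost tree at a level $\ge1$. It satisfies Matching if for every dynamically non-trivial interval component $J$ exactly one point $a$ in the interior of $J$ lands on a critical point before returning to $J$. Theorem. The set of $(\gamma\,\beta)\in\mathrm{ITM}(r)$ for which $T$ is of finite type and violates ACC or Matching has Lebesgue measure zero. Moreover, for every such $(\gamma\,\beta)$ there is a nonzero integer vector $v\in\mathbb Z^{2r-1}$ with $$\sum_{s=1}^r v_s\gamma_s+\sum_{s=1}^{r-1}v_{r+s}\beta_s=0,$$ so the set is contained in the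 countable union of the hyperplanes $v^{\perp}$, $v\in\mathbb Z^{2r-1}\setminus\{0\}$. -/

import Mathlib

open MeasureTheory Set Filter Topology

namespace ITM

/-- The ambient parameter space `ℝ^{2r-1} = ℝ^r ⊕ ℝ^{r-1}`. A parameter vector `(γ β)` has
coordinates `γ_1, …, γ_r` (left summand) and `β_1, …, β_{r-1}` (right summand), here indexed
from `0`. -/
abbrev Param (r : ℕ) : Type := (Fin r ⊕ Fin (r - 1)) → ℝ

variable {r : ℕ}

/-- The partition point `β_i` for `0 ≤ i ≤ r`, with `β_0 = 0` and `β_r = 1`. -/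
noncomputable def bp (p : Param r) (i : ℕ) : ℝ :=
  if i = 0 then 0
  else if h : i - 1 < r - 1 then p (Sum.inr ⟨i - 1, h⟩)
  else 1

/-- The polytope of parameters of interval translation maps on `r` intervals:
`0 = β_0 < β_1 < ⋯ < β_r = 1` and `γ_i ∈ [-β_{i-1}, 1 - β_i]`. The index `s : Fin r` stands for
the interval `I_{s+1} = [β_s, β_{s+1})`. -/
def space (r : ℕ) : Set (Param r) :=
  {p | (∀ s : Fin r, bp p s < bp p (s + 1)) ∧
    ∀ s : Fin r, p (Sum.inl s) ∈ Icc (-bp p s) (1 - bp p (s + 1))}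

/-- The map `T(x) = x + γ_i` for `x ∈ [β_{i-1}, β_i)` (the identity outside `[0, 1)`). -/
noncomputable def map (p : Param r) (x : ℝ) : ℝ :=
  x + ∑ s : Fin r, (Ico (bp p s) (bp p (s + 1))).indicator (fun _ => p (Sum.inl s)) x

/-- The left limits of `T`: `T(x⁻) = x + γ_i` for `x ∈ (β_{i-1}, β_i]`. -/
noncomputable def mapLeft (p : Param r) (x : ℝ) : ℝ :=
  x + ∑ s : Fin r, (Ioc (bp p s) (bp p (s + 1))).indicator (fun _ => p (Sum.inl s)) x

/-- `X_n = T^n(I)` with `I = [0, 1)`. -/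
def iterImage (p : Param r) (n : ℕ) : Set ℝ := (map p)^[n] '' Ico (0 : ℝ) 1

/-- The attractor `X = ⋂_n T^n(I)`. -/
def attractor (p : Param r) : Set ℝ := ⋂ n : ℕ, iterImage p n

/-- `T` is of finite type: `X_{n+1} = X_n = X` for some `n`. -/
def FiniteType (p : Param r) : Prop :=
  ∃ n : ℕ, iterImage p (n + 1) = iterImage p n ∧ iterImage p n = attractor p

/-- The side of a signed point. -/
inductive Side : Type where
  | plus : Side
  | minus : Side

/-- Signed points `x⁺` and `x⁻`. -/
structure SignedPoint : Type where
  pt : ℝ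
  side : Side

/-- The action of `T` on signed points: `T(x⁺) = T(x)⁺` and `T(x⁻) = (lim_{u ↑ x} T(u))⁻`. -/
noncomputable def smap (p : Param r) (z : SignedPoint) : SignedPoint :=
  match z.side with
  | Side.plus => ⟨map p z.pt, Side.plus⟩
  | Side.minus => ⟨mapLeft p z.pt, Side.minus⟩

/-- Membership of signed points in a (finite union of half-open intervals) `S`: `x⁺` lies in `S`
if `x` does, and `x⁻` lies in `S` if `S` contains a left neighbourhood of `x`. In particular
`[x, y)`, seen as a set of signed points, is `[x⁺, y⁻]`. -/
def SignedPoint.MemSet (z : SignedPoint) (S : Set ℝ) : Prop :=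
  match z.side with
  | Side.plus => z.pt ∈ S
  | Side.minus => ∀ᶠ u in 𝓝[<] z.pt, u ∈ S

/-- The critical set `𝒞 = {β_1⁻, β_1⁺, …, β_{r-1}⁻, β_{r-1}⁺}`. -/
def IsCritical (p : Param r) (z : SignedPoint) : Prop :=
  ∃ i : Fin (r - 1), z.pt = p (Sum.inr i)

/-- `J = [x, y)` is an interval component of `X`, i.e. a connected component of `X`. -/
def IsIntervalComponent (p : Param r) (x y : ℝ) : Prop :=
  x < y ∧ ∃ z ∈ attractor p, connectedComponentIn (attractor p) z = Ico x y

/-- The time `n` is strictly smaller than the return time of `a` to `J = [x, y)`. -/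
def BeforeReturn (p : Param r) (x y : ℝ) (a : SignedPoint) (n : ℕ) : Prop :=
  ∀ m : ℕ, 1 ≤ m → m ≤ n → ¬ ((smap p)^[m] a).MemSet (Ico x y)

/-- `a` lands on a critical point before returning to `J = [x, y)`; landing at time `0`, that is
`a` being itself critical, is included. -/
def LandsBeforeReturn (p : Param r) (x y : ℝ) (a : SignedPoint) : Prop :=
  ∃ n : ℕ, BeforeReturn p x y a n ∧ IsCritical p ((smap p)^[n] a)

/-- No point in the interior of `J = [x, y)` ever lands on a discontinuity. -/
def DynTrivial (p : Param r) (x y : ℝ) : Prop :=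
  ∀ a ∈ Ioo x y, ∀ σ : Side, ∀ n : ℕ, ¬ IsCritical p ((smap p)^[n] ⟨a, σ⟩)

/-- A1: for each point `a` of an interval component `J`, the orbit of `a` up to and not including
the return time to `J` contains at most one critical point. -/
def A1 (p : Param r) : Prop :=
  ∀ x y : ℝ, IsIntervalComponent p x y → ∀ a : SignedPoint, a.MemSet (Ico x y) →
    {c : SignedPoint | IsCritical p c ∧
      ∃ n : ℕ, BeforeReturn p x y a n ∧ (smap p)^[n] a = c}.Subsingleton

/-- A2: for each dynamically non-trivial `J = [x, y)`, the boundary points `x⁺`, `y⁻` do not land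
on discontinuities up to and not including the return time to `J`. -/
def A2 (p : Param r) : Prop :=
  ∀ x y : ℝ, IsIntervalComponent p x y → ¬ DynTrivial p x y →
    ¬ LandsBeforeReturn p x y ⟨x, Side.plus⟩ ∧ ¬ LandsBeforeReturn p x y ⟨y, Side.minus⟩

/-- `c` is a ghost preimage of the discontinuity `b`: a discontinuity of the sign opposite to that
of `b` that lands (after at least one step) on the opposite side of `b`. -/
def IsGhostPreimage (p : Param r) (c b : SignedPoint) : Prop :=
  IsCritical p c ∧ IsCritical p b ∧ c.side ≠ b.side ∧
    ∃ n : ℕ, 1 ≤ n ∧ (smap p)^[n] c = ⟨b.pt, c.side⟩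

/-- The set of discontinuities that appear as level `n` vertices of the ghost tree of `b`. -/
def ghostLevel (p : Param r) (b : SignedPoint) : ℕ → Set SignedPoint
  | 0 => {b}
  | n + 1 => {c | ∃ d ∈ ghostLevel p b n, IsGhostPreimage p c d}

/-- A3: for each discontinuity `b ∉ X`, the ghost tree of `b` does not contain `b` (apart from the
root, which is `b` by definition). -/
def A3 (p : Param r) : Prop :=
  ∀ b : SignedPoint, IsCritical p b → ¬ b.MemSet (attractor p) →
    ∀ n : ℕ, 1 ≤ n → b ∉ ghostLevel p b n

/-- Absence of Critical Connections. -/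
def ACC (p : Param r) : Prop := A1 p ∧ A2 p ∧ A3 p

/-- Matching: for every dynamically non-trivial `J`, exactly one point in the interior of `J` lands
on a critical point before returning to `J`. -/
def Matching (p : Param r) : Prop :=
  ∀ x y : ℝ, IsIntervalComponent p x y → ¬ DynTrivial p x y →
    ∃! a : ℝ, a ∈ Ioo x y ∧ ∃ σ : Side, LandsBeforeReturn p x y ⟨a, σ⟩

/-- The finite type maps in `ITM(r)` that violate ACC or Matching. -/
def violators (r : ℕ) : Set (Param r) :=
  {p | p ∈ space r ∧ FiniteType p ∧ (¬ ACC p ∨ ¬ Matching p)}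

/-- The hyperplane `⟨v, (γ β)⟩ = 0` of an integer coefficient vector `v` (proper when `v ≠ 0`). -/
def hyperplane (v : (Fin r ⊕ Fin (r - 1)) → ℤ) : Set (Param r) :=
  {p | ∑ i, (v i : ℝ) * p i = 0}

end ITM

/-!
Suppose that `T` is of finite type, with attractor `X`, and that its parameters satisfy no integer
relation. It is shown that ACC and Matching hold; the violators then lie in countably many
hyperplanes, each of measure zero.

An orbit segment of length `n` translates its starting point by a sum of `n` of the `γ_s`. Hence
the orbits of two critical points can meet only if they start at the same `β_i`, take equally many
steps and visit each interval `I_s` equally often (`critical_orbits_meet`), and there are no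
periodic points. This gives A1, and A3 because there are no ghost preimages. The set `X` is a finite
union of half-open intervals on which `T` is a bijection (`injOn_attractor`, by comparing lengths).
Following an endpoint of `X` backwards one meets only endpoints until a critical point occurs; as
there are finitely many endpoints and no periodic points, every endpoint is a forward image of a
critical point (`IsEndpoint.exists_origin`). So no endpoint lands on a critical point, which is A2.
The existence part of Matching follows by looking at the last visit to the component.

For the uniqueness part, let `β_i` lie in the interior of `X` and write `u_l = T^l(β_i⁻)`,
`v_l = T^l(β_i⁺)`. These are endpoints of `X` for `1 ≤ l < N`, where `N` is the first time with
`u_N = v_N`, and up to time `N` both orbits visit each `I_s` equally often (`exists_merge`).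
Consider the function `F(x) = ∑_{l < N} (1_{x < u_l} - 1_{x < v_l})`. The terms with
`u_l, v_l ∈ I_s` contribute a function supported in `I_s`, because their numbers agree and `I_s` is
an interval. On `I_s` the map `T` is a translation, and the sum telescopes, so `F` is the density of
a `T`-invariant signed measure. Therefore `F` vanishes off `X` and `F ∘ T = F` on `X`
(`density_map`). Its jumps are at endpoints of `X`, so `F` is constant on the components of `X`.
The value of `F` at a critical point `β_j` in the interior of `X` equals its jump at the endpoint
`T(β_j⁻)`, which is `1` if `j = i` and `0` otherwise (`density_critical`). If two interior points of
a component land on `β_i` and `β_j`, then `F` takes the same value at `β_i` and `β_j`, so `i = j`;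
as `T` is injective on `X`, the two points coincide or one of them visits the component again before
landing.
-/

namespace ITM

variable {r : ℕ}

/-! ### Partition cells and one-sided branches -/

/-- The opposite side. -/
def Side.opp : Side → Side
  | Side.plus => Side.minus
  | Side.minus => Side.plus

/-- The action of `T` on the positions of signed points with side `σ`. -/
noncomputable def sideMap (p : Param r) : Side → ℝ → ℝ
  | Side.plus => map p
  | Side.minus => mapLeft p

/-- The positions of the signed points with side `σ` that belong to the interval `I_{s+1}`. -/
def cell (p : Param r) : Side → Fin r → Set ℝ
  | Side.plus, s => Ico (bp p s) (bp p (s + 1))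
  | Side.minus, s => Ioc (bp p s) (bp p (s + 1))

/-- The positions of the signed points with side `σ` that belong to `I = [0, 1)`. -/
def dom : Side → Set ℝ
  | Side.plus => Ico 0 1
  | Side.minus => Ioc 0 1

@[simp] theorem bp_zero (p : Param r) : bp p 0 = 0 := by simp [bp]

theorem bp_last (hr : 2 ≤ r) (p : Param r) : bp p r = 1 := by
  have : r ≠ 0 := by omega
  simp [bp, this]

theorem bp_succ (p : Param r) (i : Fin (r - 1)) : bp p (i + 1) = p (Sum.inr i) := by
  simp [bp]

theorem bp_lt_bp {p : Param r} (hp : p ∈ space r) {i j : ℕ} (hij : i < j) (hj : j ≤ r) :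
    bp p i < bp p j := by
  induction j, hij using Nat.le_induction with
  | base => exact hp.1 ⟨i, hj⟩
  | succ j hij ih => exact (ih (by omega)).trans (hp.1 ⟨j, hj⟩)

theorem bp_le_bp {p : Param r} (hp : p ∈ space r) {i j : ℕ} (hij : i ≤ j) (hj : j ≤ r) :
    bp p i ≤ bp p j := by
  rcases hij.eq_or_lt with rfl | h
  · exact le_rfl
  · exact (bp_lt_bp hp h hj).le

theorem bp_nonneg {p : Param r} (hp : p ∈ space r) {i : ℕ} (hi : i ≤ r) : 0 ≤ bp p i := by
  simpa using bp_le_bp hp (Nat.zero_le i) hi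

theorem bp_le_one (hr : 2 ≤ r) {p : Param r} (hp : p ∈ space r) {i : ℕ} (hi : i ≤ r) :
    bp p i ≤ 1 := by
  simpa [bp_last hr] using bp_le_bp hp hi le_rfl

theorem critical_mem_Ioo (hr : 2 ≤ r) {p : Param r} (hp : p ∈ space r) (i : Fin (r - 1)) :
    p (Sum.inr i) ∈ Ioo (0 : ℝ) 1 := by
  have hi := i.2
  rw [← bp_succ p i]
  constructor
  · simpa using bp_lt_bp hp (Nat.succ_pos i) (by omega)
  · simpa [bp_last hr] using bp_lt_bp hp (show (i : ℕ) + 1 < r by omega) le_rfl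

theorem critical_mem_dom (hr : 2 ≤ r) {p : Param r} (hp : p ∈ space r) (i : Fin (r - 1))
    (σ : Side) : p (Sum.inr i) ∈ dom σ := by
  have h := critical_mem_Ioo hr hp i
  cases σ
  · exact Ioo_subset_Ico_self h
  · exact Ioo_subset_Ioc_self h

theorem cell_subset_Icc (p : Param r) (σ : Side) (s : Fin r) :
    cell p σ s ⊆ Icc (bp p s) (bp p (s + 1)) := by
  cases σ
  · exact Ico_subset_Icc_self
  · exact Ioc_subset_Icc_self

theorem exists_mem_cell (hr : 2 ≤ r) {p : Param r} {σ : Side} {x : ℝ} (hx : x ∈ dom σ) :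
    ∃ s, x ∈ cell p σ s := by
  classical
  cases σ
  · have hex : ∃ i, x < bp p i := ⟨r, by rw [bp_last hr]; exact hx.2⟩
    have h1 := Nat.find_spec hex
    have h2 : Nat.find hex ≤ r := Nat.find_min' hex (by rw [bp_last hr]; exact hx.2)
    obtain ⟨k, hk⟩ : ∃ k, Nat.find hex = k + 1 := by
      refine Nat.exists_eq_succ_of_ne_zero fun h => ?_
      rw [h, bp_zero] at h1
      exact absurd hx.1 (not_le.2 h1)
    have h3 := Nat.find_min hex (show k < Nat.find hex by omega)
    exact ⟨⟨k, by omega⟩, not_lt.1 h3, by rw [hk] at h1; exact h1⟩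
  · have hex : ∃ i, x ≤ bp p i := ⟨r, by rw [bp_last hr]; exact hx.2⟩
    have h1 := Nat.find_spec hex
    have h2 : Nat.find hex ≤ r := Nat.find_min' hex (by rw [bp_last hr]; exact hx.2)
    obtain ⟨k, hk⟩ : ∃ k, Nat.find hex = k + 1 := by
      refine Nat.exists_eq_succ_of_ne_zero fun h => ?_
      rw [h, bp_zero] at h1
      exact absurd hx.1 (not_lt.2 h1)
    have h3 := Nat.find_min hex (show k < Nat.find hex by omega)
    exact ⟨⟨k, by omega⟩, not_le.1 h3, by rw [hk] at h1; exact h1⟩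

theorem cell_unique {p : Param r} (hp : p ∈ space r) {σ : Side} {x : ℝ} {s t : Fin r}
    (hs : x ∈ cell p σ s) (ht : x ∈ cell p σ t) : s = t := by
  by_contra hne
  wlog hlt : s < t generalizing s t
  · exact this ht hs (Ne.symm hne) (lt_of_le_of_ne (not_lt.1 hlt) (Ne.symm hne))
  have h := bp_le_bp hp (show (s : ℕ) + 1 ≤ t from hlt) t.2.le
  cases σ
  · exact absurd (hs.2.trans_le (h.trans ht.1)) (lt_irrefl _)
  · exact absurd (ht.1.trans_le (hs.2.trans h)) (lt_irrefl _)

theorem sideMap_eq_sum (p : Param r) (σ : Side) (x : ℝ) :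
    sideMap p σ x = x + ∑ s, (cell p σ s).indicator (fun _ => p (Sum.inl s)) x := by
  cases σ <;> rfl

theorem sideMap_of_mem_cell {p : Param r} (hp : p ∈ space r) {σ : Side} {x : ℝ} {s : Fin r}
    (hs : x ∈ cell p σ s) : sideMap p σ x = x + p (Sum.inl s) := by
  rw [sideMap_eq_sum, Finset.sum_eq_single s]
  · rw [indicator_of_mem hs]
  · intro t _ hts
    exact indicator_of_notMem (fun ht => hts (cell_unique hp ht hs)) _
  · simp

theorem cell_subset_dom (hr : 2 ≤ r) {p : Param r} (hp : p ∈ space r) (σ : Side) (s : Fin r) :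
    cell p σ s ⊆ dom σ := by
  have h0 := bp_nonneg hp s.2.le
  have h1 := bp_le_one hr hp (show (s : ℕ) + 1 ≤ r from s.2)
  cases σ
  · exact Ico_subset_Ico h0 h1
  · exact Ioc_subset_Ioc h0 h1

theorem sideMap_mem_dom (hr : 2 ≤ r) {p : Param r} (hp : p ∈ space r) {σ : Side} {x : ℝ}
    (hx : x ∈ dom σ) : sideMap p σ x ∈ dom σ := by
  obtain ⟨s, hs⟩ := exists_mem_cell hr (p := p) hx
  rw [sideMap_of_mem_cell hp hs]
  have h := hp.2 s
  cases σ
  · exact ⟨by linarith [hs.1, h.1], by linarith [hs.2, h.2]⟩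
  · exact ⟨by linarith [hs.1, h.1], by linarith [hs.2, h.2]⟩

theorem iterate_sideMap_mem_dom (hr : 2 ≤ r) {p : Param r} (hp : p ∈ space r) {σ : Side} {x : ℝ}
    (hx : x ∈ dom σ) (n : ℕ) : (sideMap p σ)^[n] x ∈ dom σ := by
  induction n with
  | zero => exact hx
  | succ n ih => rw [Function.iterate_succ_apply']; exact sideMap_mem_dom hr hp ih

/-- Away from the critical points the two one-sided actions of `T` agree. -/
theorem sideMap_eq_of_not_critical (hr : 2 ≤ r) {p : Param r} (hp : p ∈ space r) {x : ℝ}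
    (h₁ : x ∈ dom Side.plus) (h₂ : x ∈ dom Side.minus) (hx : ∀ i, x ≠ p (Sum.inr i))
    (σ τ : Side) : sideMap p σ x = sideMap p τ x := by
  obtain ⟨s, hs⟩ := exists_mem_cell hr (p := p) h₁
  have hs' : x ∈ cell p Side.minus s := by
    refine ⟨lt_of_le_of_ne hs.1 fun h => ?_, hs.2.le⟩
    obtain ⟨s, hs0⟩ := s
    rcases s with _ | k
    · exact absurd h₂.1 (by simp [← h])
    · exact hx ⟨k, by omega⟩ (by rw [← bp_succ p]; exact h.symm)
  have e : ∀ σ, sideMap p σ x = x + p (Sum.inl s) := by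
    intro σ
    cases σ
    · exact sideMap_of_mem_cell hp hs
    · exact sideMap_of_mem_cell hp hs'
  rw [e, e]

theorem exists_cells_critical {p : Param r} (hp : p ∈ space r) (i : Fin (r - 1)) :
    ∃ s t : Fin r, s ≠ t ∧ p (Sum.inr i) ∈ cell p Side.minus s ∧
      p (Sum.inr i) ∈ cell p Side.plus t := by
  have hi := i.2
  refine ⟨⟨i, by omega⟩, ⟨i + 1, by omega⟩, by simp, ?_, ?_⟩
  · rw [← bp_succ p i]
    exact ⟨hp.1 ⟨i, by omega⟩, le_rfl⟩
  · rw [← bp_succ p i]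
    exact ⟨le_rfl, hp.1 ⟨i + 1, by omega⟩⟩

theorem eventually_left_mem_cell {p : Param r} {s : Fin r} {x : ℝ}
    (hx : x ∈ cell p Side.minus s) : ∀ᶠ u in 𝓝[<] x, u ∈ cell p Side.plus s := by
  filter_upwards [Ioo_mem_nhdsLT hx.1] with u hu
  exact ⟨hu.1.le, hu.2.trans_le hx.2⟩

theorem iterate_smap (p : Param r) (x : ℝ) (σ : Side) (n : ℕ) :
    (smap p)^[n] ⟨x, σ⟩ = ⟨(sideMap p σ)^[n] x, σ⟩ := by
  induction n with
  | zero => rfl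
  | succ n ih =>
    rw [Function.iterate_succ_apply', ih, Function.iterate_succ_apply']
    cases σ <;> rfl

/-! ### Integer relations between orbits -/

open Classical in
/-- The number of visits of the orbit segment `x, T x, …, T^{n-1} x` (on side `σ`) to the interval
`I_{s+1}`. -/
noncomputable def visits (p : Param r) (σ : Side) (x : ℝ) (n : ℕ) (s : Fin r) : ℕ :=
  ∑ l ∈ Finset.range n, if (sideMap p σ)^[l] x ∈ cell p σ s then 1 else 0

theorem iterate_sideMap_eq (p : Param r) (σ : Side) (x : ℝ) (n : ℕ) :
    (sideMap p σ)^[n] x = x + ∑ s, (visits p σ x n s : ℝ) * p (Sum.inl s) := by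
  classical
  induction n with
  | zero => simp [visits]
  | succ n ih =>
    rw [Function.iterate_succ_apply', sideMap_eq_sum]
    conv_lhs => rw [ih]
    rw [add_assoc, ← Finset.sum_add_distrib]
    congr 1
    refine Finset.sum_congr rfl fun s _ => ?_
    rw [← ih]
    simp only [visits, Finset.sum_range_succ]
    by_cases h : (sideMap p σ)^[n] x ∈ cell p σ s
    · simp [h]; ring
    · simp [h]

theorem sum_visits (hr : 2 ≤ r) {p : Param r} (hp : p ∈ space r) {σ : Side} {x : ℝ}
    (hx : x ∈ dom σ) (n : ℕ) : ∑ s, visits p σ x n s = n := by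
  classical
  simp only [visits]
  rw [Finset.sum_comm]
  have : ∀ l ∈ Finset.range n,
      ∑ s, (if (sideMap p σ)^[l] x ∈ cell p σ s then 1 else 0) = 1 := by
    intro l _
    obtain ⟨s, hs⟩ := exists_mem_cell hr (p := p) (iterate_sideMap_mem_dom hr hp hx l)
    rw [Finset.sum_eq_single s]
    · simp [hs]
    · intro t _ hts
      rw [if_neg fun ht => hts (cell_unique hp ht hs)]
    · simp
  rw [Finset.sum_congr rfl this]
  simp

theorem eq_of_relation {p : Param r} (hind : LinearIndependent ℤ p) {i j : Fin (r - 1)}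
    {a b : Fin r → ℕ}
    (h : p (Sum.inr i) + ∑ s, (a s : ℝ) * p (Sum.inl s) =
      p (Sum.inr j) + ∑ s, (b s : ℝ) * p (Sum.inl s)) : i = j ∧ a = b := by
  classical
  rw [Fintype.linearIndependent_iff] at hind
  have key := hind (Sum.elim (fun s => (a s : ℤ) - b s)
    (fun k => (if k = i then 1 else 0) - (if k = j then 1 else 0))) (by
      simp only [Fintype.sum_sum_type, Sum.elim_inl, Sum.elim_inr, Int.cast_sub, sub_mul,
        Finset.sum_sub_distrib, zsmul_eq_mul, Int.cast_natCast, Int.cast_ite, Int.cast_one,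
        Int.cast_zero, ite_mul, one_mul, zero_mul, Finset.sum_ite_eq', Finset.mem_univ, if_true]
      linarith)
  constructor
  · by_contra hne
    simpa [hne] using key (Sum.inr i)
  · funext s
    have := key (Sum.inl s)
    simp only [Sum.elim_inl] at this
    omega

/-- Under independence, two orbits of critical points meet only if they start at the same critical
position, are met after the same number of steps, and visit each interval equally often. -/
theorem critical_orbits_meet (hr : 2 ≤ r) {p : Param r} (hp : p ∈ space r)
    (hind : LinearIndependent ℤ p) {i j : Fin (r - 1)} {σ τ : Side} {n m : ℕ}
    (h : (sideMap p σ)^[n] (p (Sum.inr i)) = (sideMap p τ)^[m] (p (Sum.inr j))) :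
    i = j ∧ n = m ∧
      visits p σ (p (Sum.inr i)) n = visits p τ (p (Sum.inr j)) m := by
  rw [iterate_sideMap_eq, iterate_sideMap_eq] at h
  obtain ⟨hij, hv⟩ := eq_of_relation hind h
  refine ⟨hij, ?_, hv⟩
  rw [← sum_visits hr hp (critical_mem_dom hr hp i σ) n, hv,
    sum_visits hr hp (critical_mem_dom hr hp j τ) m]

theorem eq_zero_of_periodic (hr : 2 ≤ r) {p : Param r} (hp : p ∈ space r)
    (hind : LinearIndependent ℤ p) {σ : Side} {x : ℝ} (hx : x ∈ dom σ) {n : ℕ}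
    (h : (sideMap p σ)^[n] x = x) : n = 0 := by
  -- Adding an arbitrary `β_i` to both sides turns the relation into one between critical orbits.
  have i : Fin (r - 1) := ⟨0, by omega⟩
  rw [iterate_sideMap_eq] at h
  have := (eq_of_relation hind (i := i) (j := i) (a := visits p σ x n) (b := 0)
    (by simp only [Pi.zero_apply, Nat.cast_zero, zero_mul, Finset.sum_const_zero]; linarith)).2
  rw [← sum_visits hr hp hx n, this]
  simp

/-! ### Finite unions of half-open intervals -/

/-- `S` is a finite union of half-open intervals `[a, b)`. -/
def IsElementary (S : Set ℝ) : Prop :=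
  ∃ F : Finset (ℝ × ℝ), S = ⋃ q ∈ F, Ico q.1 q.2

theorem isElementary_Ico (a b : ℝ) : IsElementary (Ico a b) := ⟨{(a, b)}, by simp⟩

theorem IsElementary.iUnion {ι : Type*} [Fintype ι] {S : ι → Set ℝ}
    (h : ∀ i, IsElementary (S i)) : IsElementary (⋃ i, S i) := by
  classical
  choose F hF using h
  refine ⟨Finset.univ.biUnion F, ?_⟩
  ext x
  simp only [mem_iUnion, hF, Finset.mem_biUnion, Finset.mem_univ, true_and, exists_prop]
  constructor
  · rintro ⟨i, q, hq, hx⟩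
    exact ⟨q, ⟨i, hq⟩, hx⟩
  · rintro ⟨q, ⟨i, hq⟩, hx⟩
    exact ⟨i, q, hq, hx⟩

theorem IsElementary.inter_shift {S : Set ℝ} (h : IsElementary S) (a b c : ℝ) :
    IsElementary {u | u - c ∈ S ∩ Ico a b} := by
  classical
  obtain ⟨F, rfl⟩ := h
  refine ⟨F.image fun q => (max q.1 a + c, min q.2 b + c), ?_⟩
  ext u
  simp only [mem_ofPred_eq, mem_inter_iff, mem_iUnion, Finset.mem_image, exists_prop, mem_Ico]
  constructor
  · rintro ⟨⟨q, hq, h1, h2⟩, h3, h4⟩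
    exact ⟨_, ⟨q, hq, rfl⟩, by linarith [max_le h1 h3], by linarith [lt_min h2 h4]⟩
  · rintro ⟨_, ⟨q, hq, rfl⟩, h1, h2⟩
    have h3 : max q.1 a ≤ u - c := by linarith
    have h4 : u - c < min q.2 b := by linarith
    exact ⟨⟨q, hq, (le_max_left _ _).trans h3, h4.trans_le (min_le_left _ _)⟩,
      (le_max_right _ _).trans h3, h4.trans_le (min_le_right _ _)⟩

theorem IsElementary.measurableSet {S : Set ℝ} (h : IsElementary S) : MeasurableSet S := by
  obtain ⟨F, rfl⟩ := h
  exact F.measurableSet_biUnion fun q _ => measurableSet_Ico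

theorem IsElementary.exists_Ico_subset {S : Set ℝ} (h : IsElementary S) {x : ℝ} (hx : x ∈ S) :
    ∃ y, x < y ∧ Ico x y ⊆ S := by
  obtain ⟨F, rfl⟩ := h
  simp only [mem_iUnion, exists_prop] at hx
  obtain ⟨q, hq, hx⟩ := hx
  refine ⟨q.2, hx.2, fun u hu => ?_⟩
  simp only [mem_iUnion, exists_prop]
  exact ⟨q, hq, hx.1.trans hu.1, hu.2⟩

theorem eventually_left_mem_Ico {a b z : ℝ} (h₁ : a < z) (h₂ : z ≤ b) :
    ∀ᶠ u in 𝓝[<] z, u ∈ Ico a b := by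
  filter_upwards [Ioo_mem_nhdsLT h₁] with u hu
  exact ⟨hu.1.le, hu.2.trans_le h₂⟩

theorem eventually_left_notMem_Ico {a b z : ℝ} (h : ¬ (a < z ∧ z ≤ b)) :
    ∀ᶠ u in 𝓝[<] z, u ∉ Ico a b := by
  by_cases h₁ : a < z
  · have h₂ : b < z := not_le.1 fun h₂ => h ⟨h₁, h₂⟩
    filter_upwards [Ioo_mem_nhdsLT h₂] with u hu hu'
    exact absurd hu'.2 (not_lt.2 hu.1.le)
  · filter_upwards [self_mem_nhdsWithin] with u hu hu'
    exact h₁ (hu'.1.trans_lt hu)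

/-- On the left of a point, a finite union of half-open intervals is locally everything or
nothing. -/
theorem IsElementary.left_dichotomy {S : Set ℝ} (h : IsElementary S) (z : ℝ) :
    (∀ᶠ u in 𝓝[<] z, u ∈ S) ∨ (∀ᶠ u in 𝓝[<] z, u ∉ S) := by
  obtain ⟨F, rfl⟩ := h
  by_cases hq : ∃ q ∈ F, q.1 < z ∧ z ≤ q.2
  · obtain ⟨q, hq, h1, h2⟩ := hq
    left
    filter_upwards [eventually_left_mem_Ico h1 h2] with u hu
    simp only [mem_iUnion, exists_prop]
    exact ⟨q, hq, hu⟩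
  · right
    have : ∀ q ∈ F, ∀ᶠ u in 𝓝[<] z, u ∉ Ico q.1 q.2 := fun q hqF =>
      eventually_left_notMem_Ico fun hz => hq ⟨q, hqF, hz⟩
    filter_upwards [(Filter.eventually_all_finset F).2 this] with u hu
    simpa only [mem_iUnion, exists_prop, not_exists, not_and] using hu

theorem IsElementary.finite_left_endpoints {S : Set ℝ} (h : IsElementary S) :
    {x | x ∈ S ∧ ¬ ∀ᶠ u in 𝓝[<] x, u ∈ S}.Finite := by
  obtain ⟨F, rfl⟩ := h
  refine (F.finite_toSet.image Prod.fst).subset ?_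
  rintro x ⟨hx, hx'⟩
  simp only [mem_iUnion, exists_prop] at hx
  obtain ⟨q, hq, h1, h2⟩ := hx
  refine ⟨q, hq, ?_⟩
  by_contra hne
  apply hx'
  filter_upwards [eventually_left_mem_Ico (lt_of_le_of_ne h1 hne) h2.le] with u hu
  simp only [mem_iUnion, exists_prop]
  exact ⟨q, hq, hu⟩

theorem IsElementary.finite_right_endpoints {S : Set ℝ} (h : IsElementary S) :
    {x | (∀ᶠ u in 𝓝[<] x, u ∈ S) ∧ x ∉ S}.Finite := by
  obtain ⟨F, rfl⟩ := h
  refine (F.finite_toSet.image Prod.snd).subset ?_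
  rintro x ⟨hx, hx'⟩
  by_contra hne
  have : ∀ q ∈ F, ∀ᶠ u in 𝓝[<] x, u ∉ Ico q.1 q.2 := by
    intro q hq
    refine eventually_left_notMem_Ico fun hz => ?_
    rcases hz.2.lt_or_eq with h | h
    · exact hx' (by simp only [mem_iUnion, exists_prop]; exact ⟨q, hq, hz.1.le, h⟩)
    · exact hne ⟨q, hq, h.symm⟩
  obtain ⟨u, hu, hu'⟩ := (hx.and ((Filter.eventually_all_finset F).2 this)).exists
  simp only [mem_iUnion, exists_prop] at hu
  obtain ⟨q, hq, hu⟩ := hu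
  exact hu' q hq hu

/-! ### The attractor of a map of finite type -/

theorem iterImage_succ (p : Param r) (n : ℕ) : iterImage p (n + 1) = map p '' iterImage p n := by
  rw [iterImage, iterImage, Function.iterate_succ', image_comp]

theorem iterImage_subset (hr : 2 ≤ r) {p : Param r} (hp : p ∈ space r) (n : ℕ) :
    iterImage p n ⊆ Ico 0 1 := by
  rintro _ ⟨x, hx, rfl⟩
  exact iterate_sideMap_mem_dom hr hp (σ := Side.plus) hx n

theorem map_of_mem_cell {p : Param r} (hp : p ∈ space r) {x : ℝ} {s : Fin r}
    (hs : x ∈ cell p Side.plus s) : map p x = x + p (Sum.inl s) :=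
  sideMap_of_mem_cell hp (σ := Side.plus) hs

theorem image_map_eq (hr : 2 ≤ r) {p : Param r} (hp : p ∈ space r) {S : Set ℝ}
    (hS : S ⊆ Ico 0 1) :
    map p '' S = ⋃ s, {u | u - p (Sum.inl s) ∈ S ∩ cell p Side.plus s} := by
  ext u
  simp only [mem_image, mem_iUnion, mem_ofPred_eq]
  constructor
  · rintro ⟨x, hx, rfl⟩
    obtain ⟨s, hs⟩ := exists_mem_cell hr (p := p) (σ := Side.plus) (hS hx)
    refine ⟨s, ?_⟩
    rw [map_of_mem_cell hp hs, add_sub_cancel_right]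
    exact ⟨hx, hs⟩
  · rintro ⟨s, hx, hs⟩
    exact ⟨_, hx, by rw [map_of_mem_cell hp hs, sub_add_cancel]⟩

theorem isElementary_iterImage (hr : 2 ≤ r) {p : Param r} (hp : p ∈ space r) (n : ℕ) :
    IsElementary (iterImage p n) := by
  induction n with
  | zero => simpa [iterImage] using isElementary_Ico 0 1
  | succ n ih =>
    rw [iterImage_succ, image_map_eq hr hp (iterImage_subset hr hp n)]
    exact IsElementary.iUnion fun s => ih.inter_shift _ _ _

theorem isElementary_attractor (hr : 2 ≤ r) {p : Param r} (hp : p ∈ space r)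
    (hf : FiniteType p) : IsElementary (attractor p) := by
  obtain ⟨n, -, hn⟩ := hf
  rw [← hn]
  exact isElementary_iterImage hr hp n

theorem image_attractor {p : Param r} (hf : FiniteType p) :
    map p '' attractor p = attractor p := by
  obtain ⟨n, hn, hn'⟩ := hf
  rw [← hn', ← iterImage_succ, hn]

theorem attractor_subset (p : Param r) : attractor p ⊆ Ico 0 1 := by
  refine (iInter_subset _ 0).trans ?_
  simp [iterImage]

theorem volume_image_map_le (hr : 2 ≤ r) {p : Param r} (hp : p ∈ space r) {S : Set ℝ}
    (hS : S ⊆ Ico 0 1) (hm : MeasurableSet S) : volume (map p '' S) ≤ volume S := by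
  rw [image_map_eq hr hp hS]
  have hS' : S = ⋃ s, S ∩ cell p Side.plus s := by
    rw [← inter_iUnion, eq_comm, inter_eq_left]
    intro x hx
    exact mem_iUnion.2 (exists_mem_cell hr (σ := Side.plus) (hS hx))
  have hdisj : Pairwise (Function.onFun Disjoint fun s => S ∩ cell p Side.plus s) := by
    intro s t hst
    exact disjoint_left.2 fun x hx hx' => hst (cell_unique hp hx.2 hx'.2)
  calc volume (⋃ s, {u | u - p (Sum.inl s) ∈ S ∩ cell p Side.plus s})
      ≤ ∑ s, volume {u | u - p (Sum.inl s) ∈ S ∩ cell p Side.plus s} :=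
        measure_iUnion_fintype_le _ _
    _ = ∑ s, volume (S ∩ cell p Side.plus s) := by
        refine Finset.sum_congr rfl fun s _ => ?_
        simp only [sub_eq_add_neg]
        exact measure_preimage_add_right volume (-p (Sum.inl s)) (S ∩ cell p Side.plus s)
    _ = volume S := by
        conv_rhs => rw [hS', measure_iUnion hdisj fun s => hm.inter measurableSet_Ico, tsum_fintype]

/-- Since `T` does not increase length and maps the attractor onto itself, no two points of the
attractor can have the same image: otherwise an interval could be left out of the attractor
without shrinking its image. -/
theorem injOn_attractor (hr : 2 ≤ r) {p : Param r} (hp : p ∈ space r) (hf : FiniteType p) :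
    InjOn (map p) (attractor p) := by
  intro a ha b hb hab
  by_contra hne
  have hE := isElementary_attractor hr hp hf
  obtain ⟨s, hs⟩ := exists_mem_cell hr (p := p) (σ := Side.plus) (attractor_subset p ha)
  obtain ⟨t, ht⟩ := exists_mem_cell hr (p := p) (σ := Side.plus) (attractor_subset p hb)
  have hst : s ≠ t := by
    rintro rfl
    rw [map_of_mem_cell hp hs, map_of_mem_cell hp ht] at hab
    exact hne (add_right_cancel hab)
  obtain ⟨a', ha', hA⟩ := hE.exists_Ico_subset ha
  obtain ⟨b', hb', hB⟩ := hE.exists_Ico_subset hb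
  obtain ⟨ε, hε, h1, h2, h3, h4⟩ : ∃ ε > 0, ε ≤ a' - a ∧ ε ≤ b' - b ∧
      ε ≤ bp p (s + 1) - a ∧ ε ≤ bp p (t + 1) - b := by
    refine ⟨min (min (a' - a) (b' - b)) (min (bp p (s + 1) - a) (bp p (t + 1) - b)), ?_,
      (min_le_left _ _).trans (min_le_left _ _), (min_le_left _ _).trans (min_le_right _ _),
      (min_le_right _ _).trans (min_le_left _ _), (min_le_right _ _).trans (min_le_right _ _)⟩
    have := hs.2
    have := ht.2
    refine lt_min (lt_min ?_ ?_) (lt_min ?_ ?_) <;> linarith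
  have hcov : attractor p ⊆ map p '' (attractor p \ Ico a (a + ε)) := by
    intro z hz
    rw [← image_attractor hf] at hz
    obtain ⟨x, hx, rfl⟩ := hz
    by_cases hxa : x ∈ Ico a (a + ε)
    · have hxs : x ∈ cell p Side.plus s := ⟨hs.1.trans hxa.1, by linarith [hxa.2]⟩
      have hyt : b + (x - a) ∈ cell p Side.plus t :=
        ⟨by linarith [ht.1, hxa.1], by linarith [hxa.2]⟩
      refine ⟨b + (x - a), ⟨hB ⟨by linarith [hxa.1], by linarith [hxa.2]⟩, fun hy => ?_⟩, ?_⟩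
      · exact hst (cell_unique hp (σ := Side.plus) (s := s)
          ⟨hs.1.trans hy.1, by linarith [hy.2]⟩ hyt)
      · rw [map_of_mem_cell hp hs, map_of_mem_cell hp ht] at hab
        rw [map_of_mem_cell hp hxs, map_of_mem_cell hp hyt]
        linarith
    · exact ⟨x, ⟨hx, hxa⟩, rfl⟩
  have hsub : Ico a (a + ε) ⊆ attractor p := fun x hx => hA ⟨hx.1, by linarith [hx.2]⟩
  have hle := (measure_mono hcov).trans (volume_image_map_le hr hp
    (sdiff_subset.trans (attractor_subset p)) (hE.measurableSet.diff measurableSet_Ico))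
  have hfin : volume (attractor p) ≠ ⊤ :=
    ((measure_mono (attractor_subset p)).trans_lt (by simp)).ne
  rw [measure_sdiff hsub measurableSet_Ico.nullMeasurableSet (by simp)] at hle
  have hpos : 0 < volume (Ico a (a + ε)) := by simp [hε]
  exact absurd hle (not_le.2 (ENNReal.sub_lt_self hfin
    (hpos.trans_le (measure_mono hsub)).ne' hpos.ne'))

/-! ### Signed points of the attractor -/

/-- The signed point `x^σ` belongs to the attractor. -/
def InX (p : Param r) (σ : Side) (x : ℝ) : Prop :=
  (⟨x, σ⟩ : SignedPoint).MemSet (attractor p)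

theorem exists_Ioo_subset {x : ℝ} {S : Set ℝ} (h : ∀ᶠ u in 𝓝[<] x, u ∈ S) :
    ∃ l < x, Ioo l x ⊆ S :=
  mem_nhdsLT_iff_exists_Ioo_subset.1 h

theorem eventually_left_of_Ioo_subset {l x : ℝ} {S : Set ℝ} (hl : l < x) (h : Ioo l x ⊆ S) :
    ∀ᶠ u in 𝓝[<] x, u ∈ S :=
  mem_of_superset (Ioo_mem_nhdsLT hl) h

theorem mem_Ioc_of_eventually_mem_Ico {a b x : ℝ} (h : ∀ᶠ u in 𝓝[<] x, u ∈ Ico a b) :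
    x ∈ Ioc a b := by
  by_contra hx
  obtain ⟨u, hu, hu'⟩ := (h.and (eventually_left_notMem_Ico hx)).exists
  exact hu' hu

theorem InX.mem_dom {p : Param r} {σ : Side} {x : ℝ} (h : InX p σ x) : x ∈ dom σ := by
  cases σ
  · exact attractor_subset p h
  · exact mem_Ioc_of_eventually_mem_Ico (Eventually.mono h fun u hu => attractor_subset p hu)

theorem InX.sideMap (hr : 2 ≤ r) {p : Param r} (hp : p ∈ space r) (hf : FiniteType p)
    {σ : Side} {x : ℝ} (h : InX p σ x) : InX p σ (sideMap p σ x) := by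
  cases σ
  · have : map p x ∈ map p '' attractor p := mem_image_of_mem _ h
    rwa [image_attractor hf] at this
  · obtain ⟨s, hs⟩ := exists_mem_cell hr (p := p) h.mem_dom
    obtain ⟨l, hl, hlX⟩ := exists_Ioo_subset
      (S := attractor p ∩ cell p Side.plus s) (Eventually.and h (eventually_left_mem_cell hs))
    rw [sideMap_of_mem_cell hp hs]
    refine eventually_left_of_Ioo_subset (l := l + p (Sum.inl s)) (by linarith) fun u hu => ?_
    obtain ⟨h1, h2⟩ := hlX (show u - p (Sum.inl s) ∈ Ioo l x from
      ⟨by linarith [hu.1], by linarith [hu.2]⟩)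
    have : map p (u - p (Sum.inl s)) ∈ map p '' attractor p := mem_image_of_mem _ h1
    rwa [image_attractor hf, map_of_mem_cell hp h2, sub_add_cancel] at this

theorem InX.iterate (hr : 2 ≤ r) {p : Param r} (hp : p ∈ space r) (hf : FiniteType p)
    {σ : Side} {x : ℝ} (h : InX p σ x) (n : ℕ) : InX p σ ((ITM.sideMap p σ)^[n] x) := by
  induction n with
  | zero => exact h
  | succ n ih => rw [Function.iterate_succ_apply']; exact ih.sideMap hr hp hf

theorem InX.exists_preimage (hr : 2 ≤ r) {p : Param r} (hp : p ∈ space r) (hf : FiniteType p)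
    {σ : Side} {x : ℝ} (h : InX p σ x) : ∃ w, InX p σ w ∧ ITM.sideMap p σ w = x := by
  cases σ
  · have : x ∈ map p '' attractor p := by rw [image_attractor hf]; exact h
    exact this
  · have hE := isElementary_attractor hr hp hf
    -- By the dichotomy, a single branch of `T` covers a whole left neighbourhood of `x`.
    obtain ⟨s, hs⟩ : ∃ s, ∀ᶠ u in 𝓝[<] x,
        u ∈ {u | u - p (Sum.inl s) ∈ attractor p ∩ cell p Side.plus s} := by
      by_contra hno
      have : ∀ s, ∀ᶠ u in 𝓝[<] x,
          u ∉ {u | u - p (Sum.inl s) ∈ attractor p ∩ cell p Side.plus s} := fun s =>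
        ((hE.inter_shift _ _ _).left_dichotomy x).resolve_left fun h' => hno ⟨s, h'⟩
      obtain ⟨u, hu, hu'⟩ := (Eventually.and h (eventually_all.2 this)).exists
      rw [← image_attractor hf, image_map_eq hr hp (attractor_subset p)] at hu
      obtain ⟨s, hs⟩ := mem_iUnion.1 hu
      exact hu' s hs
    obtain ⟨l, hl, hlX⟩ := exists_Ioo_subset hs
    have hev : ∀ᶠ u in 𝓝[<] (x - p (Sum.inl s)), u ∈ attractor p ∩ cell p Side.plus s := by
      refine eventually_left_of_Ioo_subset (l := l - p (Sum.inl s)) (by linarith) fun u hu => ?_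
      have := hlX (show u + p (Sum.inl s) ∈ Ioo l x from
        ⟨by linarith [hu.1], by linarith [hu.2]⟩)
      rwa [mem_ofPred_eq, add_sub_cancel_right] at this
    refine ⟨x - p (Sum.inl s), hev.mono fun u hu => hu.1, ?_⟩
    rw [sideMap_of_mem_cell hp (s := s)
      (mem_Ioc_of_eventually_mem_Ico (hev.mono fun u hu => hu.2)), sub_add_cancel]

theorem InX.eq_of_sideMap_eq (hr : 2 ≤ r) {p : Param r} (hp : p ∈ space r) (hf : FiniteType p)
    {σ : Side} {x y : ℝ} (hx : InX p σ x) (hy : InX p σ y)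
    (h : ITM.sideMap p σ x = ITM.sideMap p σ y) : x = y := by
  cases σ
  · exact injOn_attractor hr hp hf hx hy h
  · obtain ⟨s, hs⟩ := exists_mem_cell hr (p := p) hx.mem_dom
    obtain ⟨t, ht⟩ := exists_mem_cell hr (p := p) hy.mem_dom
    obtain ⟨l, hl, hlX⟩ := exists_Ioo_subset
      (S := attractor p ∩ cell p Side.plus s) (Eventually.and hx (eventually_left_mem_cell hs))
    obtain ⟨m, hm, hmX⟩ := exists_Ioo_subset
      (S := attractor p ∩ cell p Side.plus t) (Eventually.and hy (eventually_left_mem_cell ht))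
    obtain ⟨ε, hε, hε'⟩ := exists_between (lt_min (sub_pos.2 hl) (sub_pos.2 hm))
    have h1 := hlX (show x - ε ∈ Ioo l x from
      ⟨by linarith [min_le_left (x - l) (y - m)], by linarith⟩)
    have h2 := hmX (show y - ε ∈ Ioo m y from
      ⟨by linarith [min_le_right (x - l) (y - m)], by linarith⟩)
    rw [sideMap_of_mem_cell hp hs, sideMap_of_mem_cell hp ht] at h
    have := injOn_attractor hr hp hf h1.1 h2.1 (by
      rw [map_of_mem_cell hp h1.2, map_of_mem_cell hp h2.2]; linarith)
    linarith

theorem InX.eq_of_iterate_eq (hr : 2 ≤ r) {p : Param r} (hp : p ∈ space r) (hf : FiniteType p)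
    {σ : Side} {x y : ℝ} (hx : InX p σ x) (hy : InX p σ y) {n : ℕ}
    (h : (ITM.sideMap p σ)^[n] x = (ITM.sideMap p σ)^[n] y) : x = y := by
  induction n with
  | zero => exact h
  | succ n ih =>
    rw [Function.iterate_succ_apply', Function.iterate_succ_apply'] at h
    exact ih ((hx.iterate hr hp hf n).eq_of_sideMap_eq hr hp hf (hy.iterate hr hp hf n) h)

/-! ### Endpoints of the attractor and their critical origin -/

@[simp] theorem Side.opp_opp (σ : Side) : σ.opp.opp = σ := by cases σ <;> rfl

/-- The signed point `x^σ` is an endpoint of the attractor: it belongs to the attractor while the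
signed point at the same position with the opposite side does not. -/
def IsEndpoint (p : Param r) (σ : Side) (x : ℝ) : Prop := InX p σ x ∧ ¬ InX p σ.opp x

theorem finite_endpoints (hr : 2 ≤ r) {p : Param r} (hp : p ∈ space r) (hf : FiniteType p)
    (σ : Side) : {x | IsEndpoint p σ x}.Finite := by
  cases σ
  · exact (isElementary_attractor hr hp hf).finite_left_endpoints
  · exact (isElementary_attractor hr hp hf).finite_right_endpoints

theorem InX.sideMap_eq (hr : 2 ≤ r) {p : Param r} (hp : p ∈ space r) {σ : Side} {x : ℝ}
    (h : InX p σ x) (h' : InX p σ.opp x) (hx : ∀ i, x ≠ p (Sum.inr i)) (τ : Side) :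
    ITM.sideMap p σ x = ITM.sideMap p τ x := by
  cases σ
  · exact sideMap_eq_of_not_critical hr hp h.mem_dom h'.mem_dom hx _ _
  · exact sideMap_eq_of_not_critical hr hp h'.mem_dom h.mem_dom hx _ _

theorem IsEndpoint.exists_preimage (hr : 2 ≤ r) {p : Param r} (hp : p ∈ space r)
    (hf : FiniteType p) {σ : Side} {x : ℝ} (h : IsEndpoint p σ x) :
    ∃ w, sideMap p σ w = x ∧ ((∃ i, w = p (Sum.inr i)) ∨ IsEndpoint p σ w) := by
  obtain ⟨w, hw, hwx⟩ := h.1.exists_preimage hr hp hf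
  refine ⟨w, hwx, ?_⟩
  by_contra! hno
  have hw' : InX p σ.opp w := by
    by_contra hw'
    exact hno.2 ⟨hw, hw'⟩
  have := hw'.sideMap hr hp hf
  rw [← hw.sideMap_eq hr hp hw' hno.1, hwx] at this
  exact h.2 this

/-- Under independence, every endpoint of the attractor is a proper forward image of a critical
point: the preimages of an endpoint are endpoints until a critical point is met, and there are only
finitely many endpoints and no periodic points. -/
theorem IsEndpoint.exists_origin (hr : 2 ≤ r) {p : Param r} (hp : p ∈ space r)
    (hf : FiniteType p) (hind : LinearIndependent ℤ p) {σ : Side} {x : ℝ}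
    (h : IsEndpoint p σ x) :
    ∃ i q, 1 ≤ q ∧ (sideMap p σ)^[q] (p (Sum.inr i)) = x := by
  by_contra hbad
  let B := {e : ℝ // IsEndpoint p σ e ∧
    ¬ ∃ i q, 1 ≤ q ∧ (sideMap p σ)^[q] (p (Sum.inr i)) = e}
  have hfin : Finite B :=
    ((finite_endpoints hr hp hf σ).subset (fun e (he : IsEndpoint p σ e ∧
      ¬ ∃ i q, 1 ≤ q ∧ (sideMap p σ)^[q] (p (Sum.inr i)) = e) => he.1)).to_subtype
  have hstep : ∀ e : B, ∃ w : B, sideMap p σ w = e := by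
    rintro ⟨e, he, hno⟩
    obtain ⟨w, hw, ⟨i, rfl⟩ | hw'⟩ := he.exists_preimage hr hp hf
    · exact absurd ⟨i, 1, le_rfl, hw⟩ hno
    · refine ⟨⟨w, hw', ?_⟩, hw⟩
      rintro ⟨i, q, hq, rfl⟩
      exact hno ⟨i, q + 1, by omega, by rw [Function.iterate_succ_apply', hw]⟩
  choose g hg using hstep
  have hback : ∀ (n : ℕ) (e : B), (sideMap p σ)^[n] (g^[n] e : B) = (e : ℝ) := by
    intro n
    induction n with
    | zero => intro e; rfl
    | succ n ih =>
      intro e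
      rw [Function.iterate_succ_apply, Function.iterate_succ_apply', hg, ih]
  obtain ⟨k, l, hkl, heq⟩ := Finite.exists_ne_map_eq_of_infinite
    (fun n : ℕ => g^[n] (⟨x, h, hbad⟩ : B))
  wlog hlt : k < l generalizing k l
  · exact this l k hkl.symm heq.symm (by omega)
  obtain ⟨d, rfl⟩ := Nat.exists_eq_add_of_lt hlt
  have h1 := hback (d + 1) (g^[k] ⟨x, h, hbad⟩)
  rw [← Function.iterate_add_apply, show d + 1 + k = k + d + 1 by omega] at h1
  change g^[k] _ = g^[k + d + 1] _ at heq
  rw [← heq] at h1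
  have := eq_zero_of_periodic hr hp hind (g^[k] ⟨x, h, hbad⟩ : B).2.1.1.mem_dom h1
  omega

theorem IsEndpoint.not_critical (hr : 2 ≤ r) {p : Param r} (hp : p ∈ space r)
    (hf : FiniteType p) (hind : LinearIndependent ℤ p) {σ : Side} {x : ℝ}
    (h : IsEndpoint p σ x) (n : ℕ) (j : Fin (r - 1)) :
    (sideMap p σ)^[n] x ≠ p (Sum.inr j) := by
  obtain ⟨i, q, hq, rfl⟩ := h.exists_origin hr hp hf hind
  intro hn
  rw [← Function.iterate_add_apply] at hn
  have := (critical_orbits_meet hr hp hind (τ := σ) (m := 0) hn).2.1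
  omega

/-! ### The two sides of a critical point merge again -/

/-- The first time at which the orbit of `β_i^σ` is no endpoint of the attractor, it meets the
orbit of `β_i` on the other side, both having visited each interval equally often. -/
theorem merge_of_minimal (hr : 2 ≤ r) {p : Param r} (hp : p ∈ space r) (hf : FiniteType p)
    (hind : LinearIndependent ℤ p) {i : Fin (r - 1)} {σ : Side} (h : InX p σ (p (Sum.inr i)))
    {k : ℕ} (hk : InX p σ.opp ((sideMap p σ)^[k + 1] (p (Sum.inr i))))
    (hmin : ∀ l, 1 ≤ l → l ≤ k → ¬ InX p σ.opp ((sideMap p σ)^[l] (p (Sum.inr i)))) :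
    (sideMap p σ)^[k + 1] (p (Sum.inr i)) = (sideMap p σ.opp)^[k + 1] (p (Sum.inr i)) ∧
      visits p σ (p (Sum.inr i)) (k + 1) = visits p σ.opp (p (Sum.inr i)) (k + 1) := by
  obtain ⟨w, hw, hwz⟩ := hk.exists_preimage hr hp hf
  obtain ⟨j, q, hq⟩ : ∃ j q, (sideMap p σ.opp)^[q] (p (Sum.inr j)) =
      (sideMap p σ)^[k + 1] (p (Sum.inr i)) := by
    by_cases hc : ∃ j, w = p (Sum.inr j)
    · obtain ⟨j, rfl⟩ := hc
      exact ⟨j, 1, hwz⟩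
    by_cases hw' : InX p σ w
    · push Not at hc
      have e : w = (sideMap p σ)^[k] (p (Sum.inr i)) := by
        refine hw'.eq_of_sideMap_eq hr hp hf (h.iterate hr hp hf k) ?_
        rw [hw'.sideMap_eq hr hp hw hc σ.opp, hwz, Function.iterate_succ_apply']
      rcases Nat.eq_zero_or_pos k with rfl | hk0
      · exact absurd e (hc i)
      · exact absurd (e ▸ hw) (hmin k hk0 le_rfl)
    · obtain ⟨j, q, -, hq⟩ := IsEndpoint.exists_origin hr hp hf hind (σ := σ.opp) (x := w)
        ⟨hw, by simpa using hw'⟩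
      exact ⟨j, q + 1, by rw [Function.iterate_succ_apply', hq, hwz]⟩
  obtain ⟨rfl, rfl, hv⟩ := critical_orbits_meet hr hp hind hq
  exact ⟨hq.symm, hv.symm⟩

/-- The points `T^k(β_i^σ)` are pairwise distinct, so only finitely many of them are endpoints. -/
theorem exists_not_endpoint (hr : 2 ≤ r) {p : Param r} (hp : p ∈ space r) (hf : FiniteType p)
    (hind : LinearIndependent ℤ p) {i : Fin (r - 1)} {σ : Side} (h : InX p σ (p (Sum.inr i))) :
    ∃ k, InX p σ.opp ((sideMap p σ)^[k + 1] (p (Sum.inr i))) := by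
  by_contra! hno
  refine Set.infinite_of_injective_forall_mem (s := {x | IsEndpoint p σ x})
    (f := fun k : ℕ => (sideMap p σ)^[k + 1] (p (Sum.inr i))) ?_
    (fun k => ⟨h.iterate hr hp hf (k + 1), hno k⟩) (finite_endpoints hr hp hf σ)
  intro k l hkl
  have := (critical_orbits_meet hr hp hind hkl).2.1
  omega

/-- The orbits of the two sides of a critical point in the interior of the attractor consist of
endpoints of the attractor up to a common time `N`, when they merge. -/
theorem exists_merge (hr : 2 ≤ r) {p : Param r} (hp : p ∈ space r) (hf : FiniteType p)
    (hind : LinearIndependent ℤ p) {i : Fin (r - 1)} (h : ∀ σ, InX p σ (p (Sum.inr i))) :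
    ∃ N, 2 ≤ N ∧ (sideMap p Side.minus)^[N] (p (Sum.inr i)) =
        (sideMap p Side.plus)^[N] (p (Sum.inr i)) ∧
      visits p Side.minus (p (Sum.inr i)) N = visits p Side.plus (p (Sum.inr i)) N ∧
      ∀ σ l, 1 ≤ l → l < N → ¬ InX p σ.opp ((sideMap p σ)^[l] (p (Sum.inr i))) := by
  classical
  have key : ∀ σ, ∃ k, ((sideMap p σ)^[k + 1] (p (Sum.inr i)) =
        (sideMap p σ.opp)^[k + 1] (p (Sum.inr i)) ∧
      visits p σ (p (Sum.inr i)) (k + 1) = visits p σ.opp (p (Sum.inr i)) (k + 1)) ∧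
      ∀ l, 1 ≤ l → l < k + 1 → ¬ InX p σ.opp ((sideMap p σ)^[l] (p (Sum.inr i))) := by
    intro σ
    have hex := exists_not_endpoint hr hp hf hind (h σ)
    have hmin : ∀ l, 1 ≤ l → l ≤ Nat.find hex →
        ¬ InX p σ.opp ((sideMap p σ)^[l] (p (Sum.inr i))) := by
      intro l hl1 hl2
      obtain ⟨l, rfl⟩ := Nat.exists_eq_add_of_le' hl1
      exact Nat.find_min hex (by omega)
    exact ⟨Nat.find hex, merge_of_minimal hr hp hf hind (h σ) (Nat.find_spec hex) hmin,
      fun l hl1 hl2 => hmin l hl1 (by omega)⟩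
  choose k hk hkmin using key
  have hle : ∀ σ, k σ.opp ≤ k σ := by
    intro σ
    by_contra! hlt
    refine hkmin σ.opp (k σ + 1) (by omega) (by omega) ?_
    rw [← (hk σ).1, Side.opp_opp]
    exact (h σ).iterate hr hp hf _
  have hkk : k Side.plus = k Side.minus := le_antisymm (hle Side.minus) (hle Side.plus)
  refine ⟨k Side.minus + 1, ?_, (hk Side.minus).1, (hk Side.minus).2, fun σ l hl1 hl2 => ?_⟩
  · by_contra hN
    have h0 : k Side.minus = 0 := by omega
    obtain ⟨s, t, hst, hs, ht⟩ := exists_cells_critical hp i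
    have hv := congrFun (hk Side.minus).2 s
    have hs' : p (Sum.inr i) ∉ cell p Side.plus s := fun h' => hst (cell_unique hp h' ht)
    rw [h0] at hv
    simp [visits, hs, hs', Side.opp] at hv
  · refine hkmin σ l hl1 ?_
    cases σ
    · rwa [hkk]
    · exact hl2

/-! ### The invariant density of a critical point -/

/-- The number of points among `b^σ, T b^σ, …, T^{N-1} b^σ` at positions larger than `x`. -/
noncomputable def countAbove (p : Param r) (σ : Side) (b : ℝ) (N : ℕ) (x : ℝ) : ℤ :=
  ∑ l ∈ Finset.range N, if x < (sideMap p σ)^[l] b then 1 else 0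

open Classical in
/-- The part of `countAbove` that is due to orbit points in the interval `I_{s+1}`. -/
noncomputable def countAboveIn (p : Param r) (σ : Side) (b : ℝ) (N : ℕ) (s : Fin r) (x : ℝ) : ℤ :=
  ∑ l ∈ Finset.range N,
    if (sideMap p σ)^[l] b ∈ cell p σ s ∧ x < (sideMap p σ)^[l] b then 1 else 0

/-- The density `∑_{l < N} (1_{x < T^l(b⁻)} - 1_{x < T^l(b⁺)})`, a signed sum of the indicator
functions of the intervals between `T^l(b⁺)` and `T^l(b⁻)`. -/
noncomputable def density (p : Param r) (b : ℝ) (N : ℕ) (x : ℝ) : ℤ :=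
  countAbove p Side.minus b N x - countAbove p Side.plus b N x

/-- The part of the density that is due to orbit points in the interval `I_{s+1}`. -/
noncomputable def densityIn (p : Param r) (b : ℝ) (N : ℕ) (s : Fin r) (x : ℝ) : ℤ :=
  countAboveIn p Side.minus b N s x - countAboveIn p Side.plus b N s x

theorem countAbove_eq_sum (hr : 2 ≤ r) {p : Param r} (hp : p ∈ space r) {σ : Side} {b : ℝ}
    (hb : b ∈ dom σ) (N : ℕ) (x : ℝ) :
    countAbove p σ b N x = ∑ s, countAboveIn p σ b N s x := by
  classical
  simp only [countAbove, countAboveIn]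
  rw [Finset.sum_comm]
  refine Finset.sum_congr rfl fun l _ => ?_
  obtain ⟨s, hs⟩ := exists_mem_cell hr (p := p) (iterate_sideMap_mem_dom hr hp hb l)
  rw [Finset.sum_eq_single s]
  · simp [hs]
  · intro t _ hts
    rw [if_neg fun ht => hts (cell_unique hp ht.1 hs)]
  · simp

theorem sum_succ_eq_sum_countAboveIn (hr : 2 ≤ r) {p : Param r} (hp : p ∈ space r) {σ : Side}
    {b : ℝ} (hb : b ∈ dom σ) (N : ℕ) (z : ℝ) :
    (∑ l ∈ Finset.range N, if z < (sideMap p σ)^[l + 1] b then 1 else 0) =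
      ∑ s, countAboveIn p σ b N s (z - p (Sum.inl s)) := by
  classical
  simp only [countAboveIn]
  rw [Finset.sum_comm]
  refine Finset.sum_congr rfl fun l _ => ?_
  obtain ⟨s, hs⟩ := exists_mem_cell hr (p := p) (iterate_sideMap_mem_dom hr hp hb l)
  rw [Finset.sum_eq_single s]
  · rw [Function.iterate_succ_apply', sideMap_of_mem_cell hp hs]
    simp [hs, sub_lt_iff_lt_add]
  · intro t _ hts
    rw [if_neg fun ht => hts (cell_unique hp ht.1 hs)]
  · simp

theorem density_eq_sum (hr : 2 ≤ r) {p : Param r} (hp : p ∈ space r) {b : ℝ}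
    (hb : ∀ σ, b ∈ dom σ) (N : ℕ) (x : ℝ) :
    density p b N x = ∑ s, densityIn p b N s x := by
  simp only [density, densityIn, Finset.sum_sub_distrib]
  rw [countAbove_eq_sum hr hp (hb _), countAbove_eq_sum hr hp (hb _)]

/-- The density is the push-forward of its parts: as the sums telescope, only the terms with
`l = 0` and `l = N` change, and both vanish. -/
theorem density_eq_sum_sub (hr : 2 ≤ r) {p : Param r} (hp : p ∈ space r) {b : ℝ}
    (hb : ∀ σ, b ∈ dom σ) {N : ℕ}
    (hN : (sideMap p Side.minus)^[N] b = (sideMap p Side.plus)^[N] b) (z : ℝ) :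
    density p b N z = ∑ s, densityIn p b N s (z - p (Sum.inl s)) := by
  have key : ∀ σ, countAbove p σ b N z + (if z < (sideMap p σ)^[N] b then 1 else 0) =
      (∑ s, countAboveIn p σ b N s (z - p (Sum.inl s))) + if z < b then 1 else 0 := by
    intro σ
    rw [← sum_succ_eq_sum_countAboveIn hr hp (hb σ), countAbove, ← Finset.sum_range_succ,
      Finset.sum_range_succ']
    rfl
  have h1 := key Side.minus
  have h2 := key Side.plus
  rw [hN] at h1
  simp only [density, densityIn, Finset.sum_sub_distrib]
  linarith

/-- As both sides visit `I_{s+1}` equally often, the part of the density due to `I_{s+1}` is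
supported in `I_{s+1}`. This is where it matters that `I_{s+1}` is an interval. -/
theorem densityIn_eq_zero {p : Param r} {b : ℝ} {N : ℕ}
    (hv : visits p Side.minus b N = visits p Side.plus b N) {s : Fin r} {x : ℝ}
    (hx : x ∉ cell p Side.plus s) : densityIn p b N s x = 0 := by
  classical
  rcases lt_or_ge x (bp p s) with h | h
  · have key : ∀ σ, countAboveIn p σ b N s x = visits p σ b N s := by
      intro σ
      simp only [countAboveIn, visits, Nat.cast_sum]
      refine Finset.sum_congr rfl fun l _ => ?_
      by_cases hl : (sideMap p σ)^[l] b ∈ cell p σ s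
      · simp [hl, h.trans_le (cell_subset_Icc p σ s hl).1]
      · simp [hl]
    rw [densityIn, key, key, hv, sub_self]
  · have h' : bp p (s + 1) ≤ x := not_lt.1 fun h' => hx ⟨h, h'⟩
    have key : ∀ σ, countAboveIn p σ b N s x = 0 := by
      intro σ
      refine Finset.sum_eq_zero fun l _ => if_neg fun hl => ?_
      exact absurd (hl.2.trans_le (cell_subset_Icc p σ s hl.1).2) (not_lt.2 h')
    rw [densityIn, key, key, sub_self]

theorem density_eq_densityIn (hr : 2 ≤ r) {p : Param r} (hp : p ∈ space r) {b : ℝ}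
    (hb : ∀ σ, b ∈ dom σ) {N : ℕ} (hv : visits p Side.minus b N = visits p Side.plus b N)
    {s : Fin r} {x : ℝ} (hx : x ∈ cell p Side.plus s) :
    density p b N x = densityIn p b N s x := by
  rw [density_eq_sum hr hp hb, Finset.sum_eq_single s]
  · intro t _ hts
    exact densityIn_eq_zero hv fun ht => hts (cell_unique hp ht hx)
  · simp

theorem density_eq_zero_of_preimages (hr : 2 ≤ r) {p : Param r} (hp : p ∈ space r) {b : ℝ}
    (hb : ∀ σ, b ∈ dom σ) {N : ℕ}
    (hN : (sideMap p Side.minus)^[N] b = (sideMap p Side.plus)^[N] b)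
    (hv : visits p Side.minus b N = visits p Side.plus b N) {z : ℝ}
    (hz : ∀ y ∈ Ico (0 : ℝ) 1, map p y = z → density p b N y = 0) : density p b N z = 0 := by
  rw [density_eq_sum_sub hr hp hb hN]
  refine Finset.sum_eq_zero fun s _ => ?_
  by_cases hs : z - p (Sum.inl s) ∈ cell p Side.plus s
  · rw [← density_eq_densityIn hr hp hb hv hs]
    exact hz _ (cell_subset_dom hr hp Side.plus s hs)
      (by rw [map_of_mem_cell hp hs, sub_add_cancel])
  · exact densityIn_eq_zero hv hs

theorem density_eq_zero (hr : 2 ≤ r) {p : Param r} (hp : p ∈ space r) {b : ℝ}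
    (hb : ∀ σ, b ∈ dom σ) {N : ℕ}
    (hN : (sideMap p Side.minus)^[N] b = (sideMap p Side.plus)^[N] b)
    (hv : visits p Side.minus b N = visits p Side.plus b N) {z : ℝ} (hz : z ∉ attractor p) :
    density p b N z = 0 := by
  have key : ∀ n, ∀ z ∉ iterImage p n, density p b N z = 0 := by
    intro n
    induction n with
    | zero =>
      intro z hz
      have hz' : z ∉ Ico (0 : ℝ) 1 := by simpa [iterImage] using hz
      refine density_eq_zero_of_preimages hr hp hb hN hv fun y hy hyz => absurd ?_ hz'
      rw [← hyz]
      exact sideMap_mem_dom hr hp (σ := Side.plus) hy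
    | succ n ih =>
      intro z hz
      refine density_eq_zero_of_preimages hr hp hb hN hv fun y _ hyz => ih y fun hy => hz ?_
      rw [iterImage_succ, ← hyz]
      exact mem_image_of_mem _ hy
  obtain ⟨n, hn⟩ : ∃ n, z ∉ iterImage p n := by simpa [attractor] using hz
  exact key n z hn

/-- The density is a `T`-invariant function on the attractor. -/
theorem density_map (hr : 2 ≤ r) {p : Param r} (hp : p ∈ space r) (hf : FiniteType p) {b : ℝ}
    (hb : ∀ σ, b ∈ dom σ) {N : ℕ}
    (hN : (sideMap p Side.minus)^[N] b = (sideMap p Side.plus)^[N] b)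
    (hv : visits p Side.minus b N = visits p Side.plus b N) {x : ℝ} (hx : x ∈ attractor p) :
    density p b N (map p x) = density p b N x := by
  obtain ⟨s, hs⟩ := exists_mem_cell hr (p := p) (σ := Side.plus) (attractor_subset p hx)
  rw [density_eq_sum_sub hr hp hb hN, Finset.sum_eq_single s]
  · rw [map_of_mem_cell hp hs, add_sub_cancel_right, density_eq_densityIn hr hp hb hv hs]
  · intro t _ hts
    by_cases ht : map p x - p (Sum.inl t) ∈ cell p Side.plus t
    · rw [← density_eq_densityIn hr hp hb hv ht]
      refine density_eq_zero hr hp hb hN hv fun hX => hts ?_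
      have := injOn_attractor hr hp hf hX hx (by rw [map_of_mem_cell hp ht, sub_add_cancel])
      rw [this] at ht
      exact cell_unique hp ht hs
    · exact densityIn_eq_zero hv ht
  · simp

theorem density_iterate_map (hr : 2 ≤ r) {p : Param r} (hp : p ∈ space r) (hf : FiniteType p)
    {b : ℝ} (hb : ∀ σ, b ∈ dom σ) {N : ℕ}
    (hN : (sideMap p Side.minus)^[N] b = (sideMap p Side.plus)^[N] b)
    (hv : visits p Side.minus b N = visits p Side.plus b N) {x : ℝ} (hx : InX p Side.plus x)
    (n : ℕ) : density p b N ((sideMap p Side.plus)^[n] x) = density p b N x := by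
  induction n with
  | zero => rfl
  | succ n ih =>
    rw [Function.iterate_succ_apply', ← ih]
    exact density_map hr hp hf hb hN hv (hx.iterate hr hp hf n)

/-- The jumps of the density are at endpoints of the attractor, so the density is constant on
intervals contained in the attractor. -/
theorem density_eq_of_Icc_subset {p : Param r} {b : ℝ} {N : ℕ}
    (hend : ∀ σ l, 1 ≤ l → l < N → ¬ InX p σ.opp ((sideMap p σ)^[l] b)) {x y : ℝ} (hxy : x ≤ y)
    (h : Icc x y ⊆ attractor p) : density p b N x = density p b N y := by
  have key : ∀ σ, ∀ l ∈ Finset.range N, l ≠ 0 →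
      ((if x < (sideMap p σ)^[l] b then 1 else 0 : ℤ) =
        if y < (sideMap p σ)^[l] b then 1 else 0) := by
    intro σ l hl hl0
    have hno := hend σ l (by omega) (Finset.mem_range.1 hl)
    by_cases h1 : x < (sideMap p σ)^[l] b
    · by_cases h2 : y < (sideMap p σ)^[l] b
      · simp [h1, h2]
      · refine absurd ?_ hno
        cases σ
        · exact eventually_left_of_Ioo_subset h1 fun u hu =>
            h ⟨hu.1.le, hu.2.le.trans (not_lt.1 h2)⟩
        · exact h ⟨h1.le, not_lt.1 h2⟩
    · have h2 : ¬ y < (sideMap p σ)^[l] b := fun h2 => h1 (hxy.trans_lt h2)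
      simp [h1, h2]
  simp only [density, countAbove, ← Finset.sum_sub_distrib]
  refine Finset.sum_congr rfl fun l hl => ?_
  rcases Nat.eq_zero_or_pos l with rfl | hl0
  · exact (sub_self _).trans (sub_self _).symm
  · rw [key _ l hl hl0.ne', key _ l hl hl0.ne']

/-- The density of `β_i` takes the value `1` at `β_i` and `0` at every other critical point `β_j` in
the interior of the attractor: its value there is its jump at the endpoint `T(β_j⁻)`. -/
theorem density_critical (hr : 2 ≤ r) {p : Param r} (hp : p ∈ space r) (hf : FiniteType p)
    (hind : LinearIndependent ℤ p) {i j : Fin (r - 1)} (hi : ∀ σ, InX p σ (p (Sum.inr i)))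
    (hj : ∀ σ, InX p σ (p (Sum.inr j))) {N : ℕ} (hN2 : 2 ≤ N)
    (hN : (sideMap p Side.minus)^[N] (p (Sum.inr i)) = (sideMap p Side.plus)^[N] (p (Sum.inr i)))
    (hv : visits p Side.minus (p (Sum.inr i)) N = visits p Side.plus (p (Sum.inr i)) N)
    (hend : ∀ σ l, 1 ≤ l → l < N → ¬ InX p σ.opp ((sideMap p σ)^[l] (p (Sum.inr i)))) :
    density p (p (Sum.inr i)) N (p (Sum.inr j)) = if i = j then 1 else 0 := by
  have hb := fun σ => critical_mem_dom hr hp i σ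
  obtain ⟨s, -, -, hs, -⟩ := exists_cells_critical hp j
  set u := sideMap p Side.minus (p (Sum.inr j)) with hu
  have hus : u = p (Sum.inr j) + p (Sum.inl s) := sideMap_of_mem_cell hp hs
  have huX : u ∉ attractor p := by
    obtain ⟨M, hM2, -, -, hM⟩ := exists_merge hr hp hf hind hj
    exact hM Side.minus 1 le_rfl (by omega)
  -- A point `x` close to `β_j` on its left, such that no orbit point lies strictly between
  -- `T x` and `u = T(β_j⁻)`.
  have hgap : ∀ σ, ∀ l ∈ Finset.range N, ∀ᶠ x in 𝓝[<] (p (Sum.inr j)),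
      (sideMap p σ)^[l] (p (Sum.inr i)) < u →
        (sideMap p σ)^[l] (p (Sum.inr i)) ≤ x + p (Sum.inl s) := by
    intro σ l _
    by_cases h : (sideMap p σ)^[l] (p (Sum.inr i)) < u
    · filter_upwards [Ioo_mem_nhdsLT (show (sideMap p σ)^[l] (p (Sum.inr i)) - p (Sum.inl s) <
        p (Sum.inr j) by linarith)] with x hx _
      linarith [hx.1]
    · exact Eventually.of_forall fun x hx => absurd hx h
  obtain ⟨c, hc, hcX⟩ := exists_Ioo_subset (hj Side.minus)
  obtain ⟨x, ⟨hxs, hxc⟩, hxm, hxp⟩ := (((eventually_left_mem_cell hs).and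
    (Ioo_mem_nhdsLT hc)).and (((Filter.eventually_all_finset _).2 (hgap Side.minus)).and
      ((Filter.eventually_all_finset _).2 (hgap Side.plus)))).exists
  have hIcc : Icc x (p (Sum.inr j)) ⊆ attractor p := by
    intro z hz
    rcases hz.2.lt_or_eq with h | rfl
    · exact hcX ⟨hxc.1.trans_le hz.1, h⟩
    · exact hj Side.plus
  have hval : density p (p (Sum.inr i)) N (p (Sum.inr j)) =
      density p (p (Sum.inr i)) N (x + p (Sum.inl s)) - density p (p (Sum.inr i)) N u := by
    rw [density_eq_zero hr hp hb hN hv huX, sub_zero, ← map_of_mem_cell hp hxs,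
      density_map hr hp hf hb hN hv (hIcc (left_mem_Icc.2 hxc.2.le)),
      density_eq_of_Icc_subset hend hxc.2.le hIcc]
  have hjump : ∀ σ, (∀ l ∈ Finset.range N, (sideMap p σ)^[l] (p (Sum.inr i)) < u →
        (sideMap p σ)^[l] (p (Sum.inr i)) ≤ x + p (Sum.inl s)) →
      countAbove p σ (p (Sum.inr i)) N (x + p (Sum.inl s)) - countAbove p σ (p (Sum.inr i)) N u =
        ∑ l ∈ Finset.range N, if (sideMap p σ)^[l] (p (Sum.inr i)) = u then 1 else 0 := by
    intro σ hσ
    rw [countAbove, countAbove, ← Finset.sum_sub_distrib]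
    refine Finset.sum_congr rfl fun l hl => ?_
    have hxu : x + p (Sum.inl s) < u := by linarith [hxc.2]
    rcases lt_trichotomy ((sideMap p σ)^[l] (p (Sum.inr i))) u with h | h | h
    · simp [h.ne, not_lt.2 (hσ l hl h), not_lt.2 h.le]
    · simp [h, hxu]
    · simp [h.ne', h, hxu.trans h]
  have hplus : ∀ l, (sideMap p Side.plus)^[l] (p (Sum.inr i)) ≠ u := fun l h =>
    huX (h ▸ (hi Side.plus).iterate hr hp hf l)
  have hminus : ∀ l, (sideMap p Side.minus)^[l] (p (Sum.inr i)) = u ↔ l = 1 ∧ i = j := by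
    intro l
    constructor
    · intro h
      obtain ⟨h1, h2, -⟩ := critical_orbits_meet hr hp hind (τ := Side.minus) (m := 1) h
      exact ⟨h2, h1⟩
    · rintro ⟨rfl, rfl⟩
      rfl
  rw [hval, density, density, sub_sub_sub_comm, hjump _ hxm, hjump _ hxp]
  simp only [hplus, hminus, if_false, Finset.sum_const_zero, sub_zero]
  by_cases hij : i = j
  · simp only [hij, and_true, if_true, Finset.sum_ite_eq', Finset.mem_range]
    exact if_pos (by omega)
  · simp [hij]

/-! ### Interval components -/

theorem memSet_Ico_iff {x y z : ℝ} {σ : Side} :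
    (⟨z, σ⟩ : SignedPoint).MemSet (Ico x y) ↔
      z ∈ Ioo x y ∨ (σ = Side.plus ∧ x < y ∧ z = x) ∨ (σ = Side.minus ∧ x < y ∧ z = y) := by
  cases σ
  · change z ∈ Ico x y ↔ _
    constructor
    · intro h
      rcases h.1.lt_or_eq with h' | rfl
      · exact Or.inl ⟨h', h.2⟩
      · exact Or.inr (Or.inl ⟨rfl, h.2, rfl⟩)
    · rintro (h | ⟨-, h, rfl⟩ | ⟨h, -⟩)
      · exact Ioo_subset_Ico_self h
      · exact left_mem_Ico.2 h
      · cases h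
  · change (∀ᶠ u in 𝓝[<] z, u ∈ Ico x y) ↔ _
    constructor
    · intro h
      have h := mem_Ioc_of_eventually_mem_Ico h
      rcases h.2.lt_or_eq with h' | rfl
      · exact Or.inl ⟨h.1, h'⟩
      · exact Or.inr (Or.inr ⟨rfl, h.1, rfl⟩)
    · rintro (h | ⟨h, -⟩ | ⟨-, h, rfl⟩)
      · exact eventually_left_mem_Ico h.1 h.2.le
      · cases h
      · exact eventually_left_mem_Ico h le_rfl

theorem SignedPoint.MemSet.mono {z : SignedPoint} {S S' : Set ℝ} (h : z.MemSet S)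
    (hS : S ⊆ S') : z.MemSet S' := by
  obtain ⟨x, σ⟩ := z
  cases σ
  · exact hS h
  · exact Eventually.mono h fun u hu => hS hu

theorem IsIntervalComponent.subset {p : Param r} {x y : ℝ} (h : IsIntervalComponent p x y) :
    Ico x y ⊆ attractor p := by
  obtain ⟨-, z, -, hz⟩ := h
  rw [← hz]
  exact connectedComponentIn_subset _ _

theorem IsIntervalComponent.subset_of_preconnected {p : Param r} {x y : ℝ}
    (h : IsIntervalComponent p x y) {S : Set ℝ} (hS : IsPreconnected S) (hSX : S ⊆ attractor p)
    (hne : (S ∩ Ico x y).Nonempty) : S ⊆ Ico x y := by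
  obtain ⟨-, z, -, hz⟩ := h
  obtain ⟨w, hw, hw'⟩ := hne
  rw [← hz] at hw' ⊢
  rw [connectedComponentIn_eq hw']
  exact hS.subset_connectedComponentIn hw hSX

theorem IsIntervalComponent.isEndpoint_left {p : Param r} {x y : ℝ}
    (h : IsIntervalComponent p x y) : IsEndpoint p Side.plus x := by
  refine ⟨h.subset (left_mem_Ico.2 h.1), fun hx => ?_⟩
  obtain ⟨l, hl, hlX⟩ := exists_Ioo_subset hx
  obtain ⟨m, hm, hm'⟩ := exists_between hl
  have := h.subset_of_preconnected (S := Icc m x) isPreconnected_Icc (fun u hu => by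
    rcases hu.2.lt_or_eq with h' | rfl
    · exact hlX ⟨hm.trans_le hu.1, h'⟩
    · exact h.subset (left_mem_Ico.2 h.1)) ⟨x, right_mem_Icc.2 hm'.le, left_mem_Ico.2 h.1⟩
  exact absurd (this (left_mem_Icc.2 hm'.le)).1 (not_le.2 hm')

theorem IsIntervalComponent.isEndpoint_right {p : Param r} {x y : ℝ}
    (h : IsIntervalComponent p x y) : IsEndpoint p Side.minus y := by
  refine ⟨(eventually_left_mem_Ico h.1 le_rfl).mono fun u hu => h.subset hu, fun hy => ?_⟩
  have := h.subset_of_preconnected (S := Icc x y) isPreconnected_Icc (fun u hu => by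
    rcases hu.2.lt_or_eq with h' | rfl
    · exact h.subset ⟨hu.1, h'⟩
    · exact hy) ⟨x, left_mem_Icc.2 h.1.le, left_mem_Ico.2 h.1⟩
  exact lt_irrefl _ (this (right_mem_Icc.2 h.1.le)).2

theorem IsIntervalComponent.inX {p : Param r} {x y : ℝ} (h : IsIntervalComponent p x y) {a : ℝ}
    (ha : a ∈ Ioo x y) (σ : Side) : InX p σ a :=
  (memSet_Ico_iff.2 (Or.inl ha)).mono h.subset

/-! ### Absence of critical connections -/

theorem isCritical_iterate_iff {p : Param r} {a : ℝ} {σ : Side} {n : ℕ} :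
    IsCritical p ((smap p)^[n] ⟨a, σ⟩) ↔ ∃ i, (sideMap p σ)^[n] a = p (Sum.inr i) := by
  rw [iterate_smap]
  rfl

theorem a1_of_independent (hr : 2 ≤ r) {p : Param r} (hp : p ∈ space r)
    (hind : LinearIndependent ℤ p) : A1 p := by
  rintro x y - ⟨a, σ⟩ - c ⟨hc, n, -, hn⟩ c' ⟨hc', m, -, hm⟩
  wlog hnm : n ≤ m generalizing c c' n m
  · exact (this hc' m hm hc n hn (by omega)).symm
  obtain ⟨d, rfl⟩ := Nat.exists_eq_add_of_le' hnm
  obtain ⟨i, hi⟩ := hc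
  obtain ⟨j, hj⟩ := hc'
  rw [Function.iterate_add_apply, hn] at hm
  rw [iterate_smap] at hn
  subst hn
  rw [iterate_smap] at hm
  subst hm
  simp only at hi hj
  rw [hi] at hj
  have := (critical_orbits_meet hr hp hind (τ := σ) (m := 0) hj).2.1
  subst this
  rfl

theorem a2_of_independent (hr : 2 ≤ r) {p : Param r} (hp : p ∈ space r) (hf : FiniteType p)
    (hind : LinearIndependent ℤ p) : A2 p := by
  intro x y h _
  constructor
  · rintro ⟨n, -, hn⟩
    obtain ⟨i, hi⟩ := isCritical_iterate_iff.1 hn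
    exact h.isEndpoint_left.not_critical hr hp hf hind n i hi
  · rintro ⟨n, -, hn⟩
    obtain ⟨i, hi⟩ := isCritical_iterate_iff.1 hn
    exact h.isEndpoint_right.not_critical hr hp hf hind n i hi

/-- Under independence there are no ghost preimages at all. -/
theorem a3_of_independent (hr : 2 ≤ r) {p : Param r} (hp : p ∈ space r)
    (hind : LinearIndependent ℤ p) : A3 p := by
  intro b _ _ n hn hb
  obtain ⟨n, rfl⟩ := Nat.exists_eq_add_of_le' hn
  obtain ⟨⟨d, τ⟩, -, ⟨i, hi⟩, ⟨j, hj⟩, -, m, hm1, hm⟩ := hb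
  obtain ⟨c, σ⟩ := b
  simp only at hi hj
  subst hi hj
  rw [iterate_smap] at hm
  have := (critical_orbits_meet hr hp hind (τ := σ) (m := 0) (congrArg SignedPoint.pt hm)).2.1
  omega

/-! ### Matching -/

/-- A point in the interior of the attractor whose orbit on one side meets a critical point meets it
on both sides at the same time, because it meets no critical point earlier. -/
theorem lands_both_sides (hr : 2 ≤ r) {p : Param r} (hp : p ∈ space r) (hf : FiniteType p)
    (hind : LinearIndependent ℤ p) {a : ℝ} (ha : ∀ τ, InX p τ a) {σ : Side} {n : ℕ}
    {i : Fin (r - 1)} (h : (sideMap p σ)^[n] a = p (Sum.inr i)) (τ : Side) :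
    (sideMap p τ)^[n] a = p (Sum.inr i) := by
  have key : ∀ m ≤ n, ∀ τ, (sideMap p τ)^[m] a = (sideMap p σ)^[m] a := by
    intro m
    induction m with
    | zero => intros; rfl
    | succ m ih =>
      intro hm τ
      have ih := ih (by omega)
      rw [Function.iterate_succ_apply', Function.iterate_succ_apply', ih τ]
      refine (InX.sideMap_eq hr hp ((ha σ).iterate hr hp hf m) ?_ ?_ τ).symm
      · rw [← ih]
        exact (ha _).iterate hr hp hf m
      · intro k hk
        obtain ⟨d, rfl⟩ := Nat.exists_eq_add_of_le' hm
        rw [← add_assoc, add_right_comm, Function.iterate_add_apply, hk] at h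
        have := (critical_orbits_meet hr hp hind (τ := σ) (m := 0) h).2.1
        omega
  rw [key n le_rfl, h]

/-- If `a` and `b` land on the same point at times `n ≤ m`, then by injectivity `a = T^{m-n}(b)`,
which is a return of `b` unless `n = m`. -/
theorem eq_of_lands_same (hr : 2 ≤ r) {p : Param r} (hp : p ∈ space r) (hf : FiniteType p)
    {x y : ℝ} (hJ : IsIntervalComponent p x y) {a b : ℝ} (ha : a ∈ Ioo x y) (hb : b ∈ Ioo x y)
    {τ : Side} {n m : ℕ} (hnm : n ≤ m) (hret : BeforeReturn p x y ⟨b, τ⟩ m)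
    (h : (sideMap p τ)^[n] a = (sideMap p τ)^[m] b) : a = b := by
  obtain ⟨d, rfl⟩ := Nat.exists_eq_add_of_le hnm
  rw [Function.iterate_add_apply] at h
  have hab := (hJ.inX ha τ).eq_of_iterate_eq hr hp hf ((hJ.inX hb τ).iterate hr hp hf d) h
  rcases Nat.eq_zero_or_pos d with rfl | hd
  · exact hab
  · refine absurd ?_ (hret d hd (by omega))
    rw [iterate_smap, ← hab]
    exact memSet_Ico_iff.2 (Or.inl ha)

theorem lands_unique (hr : 2 ≤ r) {p : Param r} (hp : p ∈ space r) (hf : FiniteType p)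
    (hind : LinearIndependent ℤ p) {x y : ℝ} (hJ : IsIntervalComponent p x y) {a b : ℝ}
    (ha : a ∈ Ioo x y) (hb : b ∈ Ioo x y) {σ τ : Side} (hla : LandsBeforeReturn p x y ⟨a, σ⟩)
    (hlb : LandsBeforeReturn p x y ⟨b, τ⟩) : a = b := by
  obtain ⟨n, hna, hn⟩ := hla
  obtain ⟨m, hmb, hm⟩ := hlb
  obtain ⟨i, hi⟩ := isCritical_iterate_iff.1 hn
  obtain ⟨j, hj⟩ := isCritical_iterate_iff.1 hm
  have hi := lands_both_sides hr hp hf hind (hJ.inX ha) hi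
  have hj := lands_both_sides hr hp hf hind (hJ.inX hb) hj
  have hiX : ∀ τ, InX p τ (p (Sum.inr i)) := fun τ =>
    hi τ ▸ (hJ.inX ha τ).iterate hr hp hf n
  have hjX : ∀ τ, InX p τ (p (Sum.inr j)) := fun τ =>
    hj τ ▸ (hJ.inX hb τ).iterate hr hp hf m
  have hij : i = j := by
    obtain ⟨N, hN2, hN, hv, hend⟩ := exists_merge hr hp hf hind hiX
    have hd := fun σ => critical_mem_dom hr hp i σ
    have hab : density p (p (Sum.inr i)) N a = density p (p (Sum.inr i)) N b := by
      rcases le_total a b with h | h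
      · exact density_eq_of_Icc_subset hend h fun u hu =>
          hJ.subset ⟨ha.1.le.trans hu.1, hu.2.trans_lt hb.2⟩
      · exact (density_eq_of_Icc_subset hend h fun u hu =>
          hJ.subset ⟨hb.1.le.trans hu.1, hu.2.trans_lt ha.2⟩).symm
    rw [← density_iterate_map hr hp hf hd hN hv (hJ.inX ha _) n, hi,
      ← density_iterate_map hr hp hf hd hN hv (hJ.inX hb _) m, hj,
      density_critical hr hp hf hind hiX hiX hN2 hN hv hend,
      density_critical hr hp hf hind hiX hjX hN2 hN hv hend] at hab
    by_contra hne
    simp [hne] at hab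
  subst hij
  rcases le_total n m with h | h
  · exact eq_of_lands_same hr hp hf hJ ha hb h hmb ((hi τ).trans (hj τ).symm)
  · exact (eq_of_lands_same hr hp hf hJ hb ha h hna ((hj σ).trans (hi σ).symm)).symm

/-- In a dynamically non-trivial component some interior point lands on a critical point before
returning: the last visit to the component of an orbit that lands on a critical point is such a
point, since endpoints never land on critical points. -/
theorem exists_lands (hr : 2 ≤ r) {p : Param r} (hp : p ∈ space r) (hf : FiniteType p)
    (hind : LinearIndependent ℤ p) {x y : ℝ} (hJ : IsIntervalComponent p x y)
    (hnt : ¬ DynTrivial p x y) :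
    ∃ a ∈ Ioo x y, ∃ σ, LandsBeforeReturn p x y ⟨a, σ⟩ := by
  classical
  simp only [DynTrivial, not_forall, not_not] at hnt
  obtain ⟨a, ha, σ, n, hn⟩ := hnt
  let V : ℕ → Prop := fun m => ((smap p)^[m] ⟨a, σ⟩).MemSet (Ico x y)
  have h0 : V 0 := memSet_Ico_iff.2 (Or.inl ha)
  have hV : V (Nat.findGreatest V n) := Nat.findGreatest_spec (Nat.zero_le n) h0
  have hle : Nat.findGreatest V n ≤ n := Nat.findGreatest_le n
  have hmax : ∀ k, Nat.findGreatest V n < k → k ≤ n → ¬ V k := fun k =>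
    Nat.findGreatest_is_greatest
  generalize Nat.findGreatest V n = m at hV hle hmax
  obtain ⟨d, rfl⟩ := Nat.exists_eq_add_of_le' hle
  change ((smap p)^[m] ⟨a, σ⟩).MemSet (Ico x y) at hV
  have hl : LandsBeforeReturn p x y ((smap p)^[m] ⟨a, σ⟩) := by
    refine ⟨d, fun q hq1 hq2 => ?_, ?_⟩
    · rw [← Function.iterate_add_apply]
      exact hmax (q + m) (by omega) (by omega)
    · rwa [← Function.iterate_add_apply]
  rw [iterate_smap] at hV hl
  obtain ⟨hx, hy⟩ := a2_of_independent hr hp hf hind x y hJ fun h => h a ha σ _ hn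
  rcases memSet_Ico_iff.1 hV with h | ⟨rfl, -, h⟩ | ⟨rfl, -, h⟩
  · exact ⟨_, h, σ, hl⟩
  · exact absurd (h ▸ hl) hx
  · exact absurd (h ▸ hl) hy

theorem matching_of_independent (hr : 2 ≤ r) {p : Param r} (hp : p ∈ space r)
    (hf : FiniteType p) (hind : LinearIndependent ℤ p) : Matching p := by
  intro x y hJ hnt
  obtain ⟨a, ha, σ, hla⟩ := exists_lands hr hp hf hind hJ hnt
  refine ⟨a, ⟨ha, σ, hla⟩, ?_⟩
  rintro b ⟨hb, τ, hlb⟩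
  exact lands_unique hr hp hf hind hJ hb ha hlb hla

/-! ### The hyperplanes -/

theorem volume_hyperplane {v : (Fin r ⊕ Fin (r - 1)) → ℤ} (hv : v ≠ 0) :
    volume (hyperplane v) = 0 := by
  classical
  let L : Param r →ₗ[ℝ] ℝ := ∑ i, (v i : ℝ) • LinearMap.proj i
  have hL : hyperplane v = (LinearMap.ker L : Set (Param r)) := by
    ext q
    simp [hyperplane, L, LinearMap.sum_apply]
  rw [hL]
  refine Measure.addHaar_submodule _ _ fun htop => hv ?_
  funext k
  have hk : Pi.single k 1 ∈ LinearMap.ker L := by rw [htop]; trivial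
  rcases k with k | k <;> simpa [L, LinearMap.sum_apply, Pi.single_apply] using hk

theorem exists_relation_of_violator (hr : 2 ≤ r) {p : Param r} (hp : p ∈ violators r) :
    ∃ v : (Fin r ⊕ Fin (r - 1)) → ℤ, v ≠ 0 ∧ ∑ i, (v i : ℝ) * p i = 0 := by
  obtain ⟨hp, hf, hbad⟩ := hp
  by_contra! hno
  have hind : LinearIndependent ℤ p := by
    rw [Fintype.linearIndependent_iff]
    intro g hg
    by_contra! hg'
    obtain ⟨k, hk⟩ := hg'
    exact hno g (fun h => hk (congrFun h k)) (by simpa only [zsmul_eq_mul] using hg)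
  rcases hbad with h | h
  · exact h ⟨a1_of_independent hr hp hind, a2_of_independent hr hp hf hind,
      a3_of_independent hr hp hind⟩
  · exact h (matching_of_independent hr hp hf hind)

end ITM

theorem mainTheorem5 (r : ℕ) (hr : 2 ≤ r) :
    volume (ITM.violators r) = 0 ∧
    (∀ p ∈ ITM.violators r,
      ∃ v : (Fin r ⊕ Fin (r - 1)) → ℤ, v ≠ 0 ∧ ∑ i, (v i : ℝ) * p i = 0) ∧
    ITM.violators r ⊆
      ⋃ v ∈ {v : (Fin r ⊕ Fin (r - 1)) → ℤ | v ≠ 0}, ITM.hyperplane v := by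
  have hrel := fun p hp => ITM.exists_relation_of_violator hr (p := p) hp
  have hsub : ITM.violators r ⊆
      ⋃ v ∈ {v : (Fin r ⊕ Fin (r - 1)) → ℤ | v ≠ 0}, ITM.hyperplane v := by
    intro p hp
    obtain ⟨v, hv, hvp⟩ := hrel p hp
    exact mem_biUnion hv hvp
  refine ⟨measure_mono_null hsub ?_, hrel, hsub⟩
  exact (measure_biUnion_null_iff (to_countable _)).2 fun v hv => ITM.volume_hyperplane hv
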